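/- Let $d\ge 1$ and $N\ge 0$ be integers, and let $$\widehat D=\Big\{x\in\mathbb R^d:\ x_j\ge -1\ (1\le j\le d),\ \sum_{j=1}^d x_j\le 2-d\Big\}$$ be the bi-unit right simplex, with barycentric coordinates $t_0=1-\sum_{j}\frac{1+x_j}{2}$ and $t_j=\frac{1+x_j}{2}$ for $1\le j\le d$. For a multi-index $\alpha\in\mathbb N^{d+1}$ with $|\alpha|=N$ let $B^N_\alpha=\frac{N!}{\alpha_0!\cdots\alpha_d!}\,t_0^{\alpha_0}\cdots t_d^{\alpha_d}$ be the Bernstein polynomial. For $0\le k\le d$ let $f_k=\{x\in\widehat D: t_k(x)=0\}$ be the face opposite to vertex $k$, and define the Bernstein mass matrix and face mass matrices of degree $N$ by $$M_{\alpha\beta}=\int_{\widehat D}B^N_\beta B^N_\alpha\,dx,\qquad (M_{f_k})_{\alpha\beta}=\int_{f_k}B^N_\beta B^N_\alpha\,dS,$$ where $dS$ is surface measure (counting measure if $d=1$). On a $(d-1)$-dimensional simplex (with $d$ barycentric coordinates) let $E=E^{N+1}_N$ be the degree elevation matrix, whose column $\alpha$ ($|\alpha|=N$) contains the coefficients of $B^N_\alpha=\sum_{j}\frac{\alpha_j+1}{N+1}B^{N+1}_{\alpha+e_j}$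 in the Bernstein basis of degree $N+1$, and put $$L_0=\frac{(N+1)^2}{2}\,\big(E^{N+1}_N\big)^{T}E^{N+1}_N .$$ Put $c_k=1$ for $1\le k\le d$ (the faces in the hyperplanes $x_k=-1$) and $c_0=\sqrt d$ (the oblique face), and $$\lambda_i=\frac{(N+i+d)(N+1-i)}{2},\qquad i=0,\dots,N .$$ Then for every face $f_k$ the nonzero eigenvalues $\lambda$ of the generalized eigenvalue problem $$M_{f_k}u=\lambda Mu,\qquad u\ne0,$$ are exactly the numbers $c_k\mu$ with $\mu$ an eigenvalue of $L_0$, with the same multiplicities: for every $\mu\neq0$ the space $\{u: M_{f_k}u=c_k\mu Mu\}$ has the same dimension as the $\mu$-eigenspace of $L_0$. Explicitly, if $d\ge2$, the set of eigenvalues of $L_0$ is $\{\lambda_0,\dots,\lambda_N\}$, and the set of nonzero generalized eigenvalues of $M_{f_k}u=\lambda Mu$ is $\{c_k\lambda_0,\dots,c_k\lambda_N\}$; in particular it is $\{\lambda_0,\dots,\lambda_N\}$ for the faces $f_1,\dots,f_d$. If $d=1$, the same holds with only $i=0$ occurring, so that both sets are $\{\lambda_0\}=\{(N+1)^2/2\}$.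 -/

import Mathlib

open MeasureTheory
open scoped Nat Matrix

noncomputable section

namespace BernsteinLift

/-- Multi-indices `α = (α_0, …, α_{m-1})` of natural numbers with `|α| = N`; they label the
Bernstein polynomials of degree `N` in `m` barycentric coordinates (a simplex with `m` vertices). -/
abbrev MultiIndex (m N : ℕ) : Type :=
  {α : Fin m → ℕ // α ∈ Finset.piAntidiag (Finset.univ : Finset (Fin m)) N}

/-- The Bernstein polynomial `N! / (∏ α_j!) * ∏ t_j ^ α_j`, as a function of the barycentric
coordinates `t`. -/
def bernstein {m N : ℕ} (α : MultiIndex m N) (t : Fin m → ℝ) : ℝ :=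
  (N ! : ℝ) / (∏ j, ((α.1 j)! : ℝ)) * ∏ j, t j ^ α.1 j

/-- The degree elevation matrix from degree `N` to degree `N + 1` on a simplex with `m` vertices:
the column of `α` holds the coefficients of `B^N_α = ∑_j (α_j + 1) / (N + 1) B^{N+1}_{α + e_j}`. -/
def elevation (m N : ℕ) : Matrix (MultiIndex m (N + 1)) (MultiIndex m N) ℝ :=
  Matrix.of fun β α =>
    ∑ j : Fin m, if β.1 = α.1 + Pi.single j 1 then ((α.1 j : ℝ) + 1) / ((N : ℝ) + 1) else 0

/-- `L_0 = (N+1)^2 / 2 * Eᵀ E`, with `E` the degree elevation matrix from degree `N` to `N + 1` on a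
face of a `d`-dimensional simplex, that is, on a simplex with `d` vertices. -/
def liftZero (d N : ℕ) : Matrix (MultiIndex d N) (MultiIndex d N) ℝ :=
  (((N : ℝ) + 1) ^ 2 / 2) • ((elevation d N)ᵀ * elevation d N)

/-- Barycentric coordinates on the bi-unit right simplex in dimension `d`:
`1 - ∑_j (1 + x_j) / 2` at the vertex `(-1, …, -1)`, and `(1 + x_j) / 2` at the other vertices. -/
def bary {d : ℕ} (x : EuclideanSpace ℝ (Fin d)) : Fin (d + 1) → ℝ :=
  Fin.cons (1 - ∑ j, (1 + x j) / 2) fun j => (1 + x j) / 2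

/-- The bi-unit right reference simplex, with vertices `(-1, …, -1)` and `(-1, …, -1) + 2 e_j`. -/
def refSimplex (d : ℕ) : Set (EuclideanSpace ℝ (Fin d)) :=
  {x | (∀ j, -1 ≤ x j) ∧ ∑ j, x j ≤ 2 - (d : ℝ)}

/-- The face of the reference simplex opposite to the vertex `k`. -/
def refFace (d : ℕ) (k : Fin (d + 1)) : Set (EuclideanSpace ℝ (Fin d)) :=
  {x | x ∈ refSimplex d ∧ bary x k = 0}

/-- The Bernstein mass matrix of degree `N` on the reference simplex. -/
def massMatrix (d N : ℕ) : Matrix (MultiIndex (d + 1) N) (MultiIndex (d + 1) N) ℝ :=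
  Matrix.of fun α β => ∫ x in refSimplex d, bernstein β (bary x) * bernstein α (bary x)

/-- The Bernstein face mass matrix of degree `N` for the face opposite to the vertex `k`; the
integral is with respect to surface measure (`(d-1)`-dimensional Hausdorff measure, normalised to
agree with Lebesgue measure on `(d-1)`-dimensional Euclidean space). -/
def faceMassMatrix (d N : ℕ) (k : Fin (d + 1)) :
    Matrix (MultiIndex (d + 1) N) (MultiIndex (d + 1) N) ℝ :=
  Matrix.of fun α β =>
    ∫ x in refFace d k, bernstein β (bary x) * bernstein α (bary x) ∂μHE[d - 1]

/-- `lam` is an eigenvalue of the generalized eigenvalue problem `A u = lam B u`. -/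
def IsGeneralizedEigenvalue {ι : Type*} [Fintype ι] (A B : Matrix ι ι ℝ) (lam : ℝ) : Prop :=
  ∃ u : ι → ℝ, u ≠ 0 ∧ A *ᵥ u = lam • (B *ᵥ u)

/-- The space of solutions `u` of `A u = lam B u`. -/
def generalizedSolutions {ι : Type*} [Fintype ι] (A B : Matrix ι ι ℝ) (lam : ℝ) :
    Submodule ℝ (ι → ℝ) :=
  LinearMap.ker (A.mulVecLin - lam • B.mulVecLin)

/-- The scaling factor of the face opposite to the vertex `k`: it is `√d` for the oblique face
(opposite to `(-1, …, -1)`) and `1` for the faces that lie in the hyperplanes `x_j = -1`. -/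
def faceScale (d : ℕ) (k : Fin (d + 1)) : ℝ :=
  if k = 0 then √(d : ℝ) else 1

/-- The number `(N + i + d) (N + 1 - i) / 2`. -/
def traceEigenvalue (d N i : ℕ) : ℝ :=
  ((N : ℝ) + i + d) * ((N : ℝ) + 1 - i) / 2

theorem sum_bary {d : ℕ} (x : EuclideanSpace ℝ (Fin d)) : ∑ k, bary x k = 1 := by
  simp [bary, Fin.sum_univ_succ]

theorem mem_refSimplex_iff {d : ℕ} (x : EuclideanSpace ℝ (Fin d)) :
    x ∈ refSimplex d ↔ ∀ k, 0 ≤ bary x k := by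
  have h : ∑ j, (1 + x j) / 2 = ((d : ℝ) + ∑ j, x j) / 2 := by
    rw [← Finset.sum_div, Finset.sum_add_distrib]; simp
  simp only [refSimplex, bary, Set.mem_ofPred_eq, Fin.forall_fin_succ, Fin.cons_zero, Fin.cons_succ,
    h]
  constructor
  · rintro ⟨h1, h2⟩
    exact ⟨by linarith, fun j => by linarith [h1 j]⟩
  · rintro ⟨h1, h2⟩
    exact ⟨fun j => by linarith [h2 j], by linarith⟩

/-- The multi-index `α + e_j`. -/
def MultiIndex.succ {m N : ℕ} (α : MultiIndex m N) (j : Fin m) : MultiIndex m (N + 1) :=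
  ⟨α.1 + Pi.single j 1, by
    have h := α.2
    simp only [Finset.mem_piAntidiag, Finset.mem_univ, implies_true, and_true] at h ⊢
    simp [Finset.sum_add_distrib, h]⟩

/-- The matrix `elevation m N` expresses polynomials of degree `N` in the Bernstein basis of degree
`N + 1`. -/
theorem bernstein_eq_sum_elevation {m N : ℕ} (α : MultiIndex m N) (t : Fin m → ℝ)
    (ht : ∑ j, t j = 1) :
    bernstein α t = ∑ β, elevation m N β α * bernstein β t := by
  have key : ∀ j : Fin m, ((α.1 j : ℝ) + 1) / ((N : ℝ) + 1) * bernstein (α.succ j) t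
      = t j * bernstein α t := by
    intro j
    have h1 : ∏ i, (((α.succ j).1 i)! : ℝ) = ((α.1 j : ℝ) + 1) * ∏ i, ((α.1 i)! : ℝ) := by
      rw [← Finset.mul_prod_erase _ _ (Finset.mem_univ j),
        ← Finset.mul_prod_erase (f := fun i => ((α.1 i)! : ℝ)) _ (Finset.mem_univ j), ← mul_assoc]
      congr 1
      · simp [MultiIndex.succ, Nat.factorial_succ]
      · refine Finset.prod_congr rfl fun i hi => ?_
        simp [MultiIndex.succ, Pi.single_eq_of_ne (Finset.ne_of_mem_erase hi)]
    have h2 : ∏ i, t i ^ (α.succ j).1 i = t j * ∏ i, t i ^ α.1 i := by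
      rw [← Finset.mul_prod_erase _ _ (Finset.mem_univ j),
        ← Finset.mul_prod_erase (f := fun i => t i ^ α.1 i) _ (Finset.mem_univ j), ← mul_assoc]
      congr 1
      · simp [MultiIndex.succ, pow_succ']
      · refine Finset.prod_congr rfl fun i hi => ?_
        simp [MultiIndex.succ, Pi.single_eq_of_ne (Finset.ne_of_mem_erase hi)]
    have h3 : (∏ i, ((α.1 i)! : ℝ)) ≠ 0 :=
      Finset.prod_ne_zero_iff.2 fun i _ => Nat.cast_ne_zero.2 (Nat.factorial_ne_zero _)
    unfold bernstein
    rw [h1, h2, Nat.factorial_succ]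
    push_cast
    have h4 : (α.1 j : ℝ) + 1 ≠ 0 := by positivity
    have h5 : (N : ℝ) + 1 ≠ 0 := by positivity
    field_simp
  calc bernstein α t = ∑ j, t j * bernstein α t := by rw [← Finset.sum_mul, ht, one_mul]
    _ = ∑ j, ((α.1 j : ℝ) + 1) / ((N : ℝ) + 1) * bernstein (α.succ j) t :=
        Finset.sum_congr rfl fun j _ => (key j).symm
    _ = ∑ j, ∑ β : MultiIndex m (N + 1),
          (if β.1 = α.1 + Pi.single j 1 then ((α.1 j : ℝ) + 1) / ((N : ℝ) + 1) else 0)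
            * bernstein β t := by
        refine Finset.sum_congr rfl fun j _ => ?_
        rw [Finset.sum_eq_single (α.succ j)]
        · simp [MultiIndex.succ]
        · intro β _ hβ
          rw [if_neg, zero_mul]
          intro h
          exact hβ (Subtype.ext h)
        · simp
    _ = ∑ β, elevation m N β α * bernstein β t := by
        rw [Finset.sum_comm]
        simp [elevation, Finset.sum_mul]

end BernsteinLift

end

open BernsteinLift

/-! Let `Φ = factorialFunctional` send `t^α` to `∏ α_j!`; it is the integral against `exp (-∑ t_j)`
over the positive orthant. By Dirichlet's formula, integrals over the reference simplex of
homogeneous polynomials of a fixed degree are a constant times `Φ`, so both matrices are Gram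
matrices of `Φ`: one on the simplex, one on the face after setting `t_k = 0`.

Write `s = ∑ t_j` and `D = ∑ ∂_j t_j ∂_j` (`varSum`, `lowering`) on a face. Degree elevation is
multiplication by `s` and its transpose is `D / (N+1)^2`, so `L_0` acts as `(1/2) D s` on forms of
degree `N` (`toPoly_liftZero_mulVec`).

The trace `T` onto the face has the explicit lift `Λ g = ∑_j (-1)^j / (j! (j+1)!) t_k^j D^(j+1) (s
g)` (`polyLift`) with two properties. Only the term `j = 0` survives on the face, so `T Λ = D s = 2
L_0`. Moreover `Φ (Λ g * V) = (2N+d) Φ (g * T V)` (`factorialFunctional_polyLift_mul`), which gives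
`M_f = (c_k/2) M Λ T` (`faceMassMatrix_mulVec`). Since `M` is injective, `M_f u = c_k μ M u` means
`Λ T u = 2 μ u`, and `Λ T` and `T Λ` have the same nonzero eigenvalues with the same multiplicities.

The spectrum of `L_0` is a ladder computation: on degree `n` in `m` variables, `D s - s D = 2n + m`
(`lowering_varSum_mul`). An element of `ker D` in degree `i`, multiplied by `s^(N-i)`, is an
eigenvector of `D s` with eigenvalue `∑_{n=i}^N (2n+m) = 2 λ_i`, and conversely applying `D` to an
eigenvector ends in `ker D`. -/

noncomputable section

namespace BernsteinLift

open MvPolynomial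

/-! ### The factorial functional and the operator `∑ ∂_j t_j ∂_j`. -/

section FactorialFunctional

variable {σ : Type*} [Fintype σ]

/-- The linear functional on polynomials that sends the monomial `t ^ α` to `∏ j, (α j)!`. -/
def factorialFunctional (σ : Type*) [Fintype σ] : MvPolynomial σ ℝ →ₗ[ℝ] ℝ :=
  (basisMonomials σ ℝ).constr ℝ fun α => ∏ j, ((α j)! : ℝ)

@[simp]
theorem factorialFunctional_monomial (α : σ →₀ ℕ) (r : ℝ) :
    factorialFunctional σ (monomial α r) = r * ∏ j, ((α j)! : ℝ) := by
  have h : monomial α r = r • basisMonomials σ ℝ α := by simp [smul_monomial]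
  rw [h, map_smul, factorialFunctional, Module.Basis.constr_basis, smul_eq_mul]

/-- Integration by parts against `exp (-∑ t_j)`: there is no boundary term because `X j * p`
vanishes on `t_j = 0`. -/
theorem factorialFunctional_pderiv_X_mul (j : σ) (p : MvPolynomial σ ℝ) :
    factorialFunctional σ (pderiv j (X j * p)) = factorialFunctional σ (X j * p) := by
  classical
  induction p using MvPolynomial.induction_on' with
  | add p q hp hq => simp only [mul_add, map_add, hp, hq]
  | monomial α r =>
    have h1 : (X j * monomial α r : MvPolynomial σ ℝ) = monomial (α + Finsupp.single j 1) r := by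
      rw [X, monomial_mul, one_mul, add_comm]
    rw [h1, pderiv_monomial, factorialFunctional_monomial, factorialFunctional_monomial,
      add_tsub_cancel_right, ← Finset.mul_prod_erase _ _ (Finset.mem_univ j),
      ← Finset.mul_prod_erase (f := fun i => (((α + Finsupp.single j 1 : σ →₀ ℕ) i)! : ℝ)) _
        (Finset.mem_univ j)]
    have h2 : ∏ i ∈ Finset.univ.erase j, (((α + Finsupp.single j 1 : σ →₀ ℕ) i)! : ℝ)
        = ∏ i ∈ Finset.univ.erase j, ((α i)! : ℝ) :=
      Finset.prod_congr rfl fun i hi => by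
        simp [Finsupp.single_eq_of_ne (Finset.ne_of_mem_erase hi)]
    rw [h2]
    simp [Nat.factorial_succ]
    ring

/-- The sum of the variables. -/
def varSum (σ : Type*) [Fintype σ] : MvPolynomial σ ℝ := ∑ j, X j

theorem isHomogeneous_varSum : (varSum σ).IsHomogeneous 1 :=
  IsHomogeneous.sum _ _ _ fun j _ => isHomogeneous_X ℝ j

/-- The operator `∑ j, ∂_j t_j ∂_j`, adjoint to multiplication by the sum of the variables with
respect to the inner product for which suitably scaled Bernstein polynomials are orthonormal. -/
def lowering (σ : Type*) [Fintype σ] : MvPolynomial σ ℝ →ₗ[ℝ] MvPolynomial σ ℝ :=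
  ∑ j, (pderiv j).toLinearMap ∘ₗ LinearMap.mulLeft ℝ (X j) ∘ₗ (pderiv j).toLinearMap

theorem lowering_apply (p : MvPolynomial σ ℝ) :
    lowering σ p = ∑ j, pderiv j (X j * pderiv j p) := by
  simp [lowering]

theorem pderiv_eq_zero_of_isHomogeneous_zero {σ : Type*} {p : MvPolynomial σ ℝ} (hp : p.IsHomogeneous 0)
    (j : σ) : pderiv j p = 0 := by
  rw [← totalDegree_zero_iff_isHomogeneous, totalDegree_eq_zero_iff_eq_C] at hp
  rw [hp, pderiv_C]

theorem lowering_of_isHomogeneous_zero {p : MvPolynomial σ ℝ} (hp : p.IsHomogeneous 0) :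
    lowering σ p = 0 := by
  simp [lowering_apply, pderiv_eq_zero_of_isHomogeneous_zero hp]

theorem isHomogeneous_lowering {n : ℕ} {p : MvPolynomial σ ℝ} (hp : p.IsHomogeneous n) :
    (lowering σ p).IsHomogeneous (n - 1) := by
  rcases n with _ | n
  · rw [lowering_of_isHomogeneous_zero hp]
    exact isHomogeneous_zero _ _ _
  · rw [lowering_apply]
    refine IsHomogeneous.sum _ _ _ fun j _ => IsHomogeneous.pderiv ?_
    rw [add_comm n 1]
    exact (isHomogeneous_X ℝ j).mul hp.pderiv

theorem isHomogeneous_lowering_iterate {n : ℕ} {p : MvPolynomial σ ℝ} (hp : p.IsHomogeneous n)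
    (i : ℕ) : ((lowering σ)^[i] p).IsHomogeneous (n - i) := by
  induction i with
  | zero => exact hp
  | succ i ih =>
    rw [Function.iterate_succ_apply']
    exact isHomogeneous_lowering ih

theorem lowering_iterate_eq_zero {n : ℕ} {p : MvPolynomial σ ℝ} (hp : p.IsHomogeneous n) :
    (lowering σ)^[n + 1] p = 0 := by
  rw [Function.iterate_succ_apply']
  refine lowering_of_isHomogeneous_zero ?_
  simpa using isHomogeneous_lowering_iterate hp n

theorem factorialFunctional_varSum_mul {n : ℕ} {p : MvPolynomial σ ℝ} (hp : p.IsHomogeneous n) :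
    factorialFunctional σ (varSum σ * p) = (n + Fintype.card σ) * factorialFunctional σ p := by
  have h : ∀ j, factorialFunctional σ (X j * p)
      = factorialFunctional σ p + factorialFunctional σ (X j * pderiv j p) := fun j => by
    rw [← factorialFunctional_pderiv_X_mul, pderiv_mul, pderiv_X_self, one_mul, map_add]
  rw [varSum, Finset.sum_mul, map_sum, Finset.sum_congr rfl fun j _ => h j,
    Finset.sum_add_distrib, ← map_sum _ fun j => X j * pderiv j p, hp.sum_X_mul_pderiv,
    map_nsmul, nsmul_eq_mul]
  simp
  ring

/-- Integrating by parts leaves a Dirichlet form symmetric in `p` and `q`, while Euler's identity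
supplies the factor `n`. Hence only the difference of the degrees obstructs symmetry of `lowering`.
-/
theorem factorialFunctional_lowering_mul {n : ℕ} {p : MvPolynomial σ ℝ} (hp : p.IsHomogeneous n)
    (q : MvPolynomial σ ℝ) :
    factorialFunctional σ (lowering σ p * q) = n * factorialFunctional σ (p * q)
      - ∑ j, factorialFunctional σ (X j * (pderiv j p * pderiv j q)) := by
  have h : ∀ j, factorialFunctional σ (X j * pderiv j p * q)
      = factorialFunctional σ (pderiv j (X j * pderiv j p) * q)
        + factorialFunctional σ (X j * (pderiv j p * pderiv j q)) := fun j => by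
    rw [mul_assoc, ← factorialFunctional_pderiv_X_mul, ← mul_assoc, pderiv_mul, map_add, mul_assoc]
  rw [lowering_apply, Finset.sum_mul, map_sum, eq_sub_iff_add_eq, ← Finset.sum_add_distrib,
    ← Finset.sum_congr rfl fun j _ => h j, ← map_sum, ← Finset.sum_mul, hp.sum_X_mul_pderiv,
    smul_mul_assoc, map_nsmul, nsmul_eq_mul]

/-- Up to the difference of the degrees, `lowering` is symmetric for `factorialFunctional`. -/
theorem factorialFunctional_lowering_mul_comm {n m : ℕ} {p q : MvPolynomial σ ℝ}
    (hp : p.IsHomogeneous n) (hq : q.IsHomogeneous m) :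
    factorialFunctional σ (lowering σ p * q) = factorialFunctional σ (p * lowering σ q)
      + ((n : ℝ) - m) * factorialFunctional σ (p * q) := by
  rw [factorialFunctional_lowering_mul hp, mul_comm p (lowering σ q),
    factorialFunctional_lowering_mul hq, mul_comm q p,
    Finset.sum_congr rfl fun j _ => by rw [mul_comm (pderiv j p) (pderiv j q)]]
  ring

/-- The commutation relation behind the spectrum of `L_0`. Each `∂_j` of the sum is `1`, and Euler's
identity evaluates the cross terms. -/
theorem lowering_varSum_mul {n : ℕ} {p : MvPolynomial σ ℝ} (hp : p.IsHomogeneous n) :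
    lowering σ (varSum σ * p)
      = (2 * n + Fintype.card σ : ℝ) • p + varSum σ * lowering σ p := by
  have hs : ∀ j, pderiv j (varSum σ) = 1 := fun j => by
    classical
    simp [varSum, pderiv_X, Pi.single_apply]
  have h : ∀ j, pderiv j (X j * pderiv j (varSum σ * p))
      = p + 2 * (X j * pderiv j p) + varSum σ * pderiv j (X j * pderiv j p) := fun j => by
    simp only [pderiv_mul, hs, map_add, pderiv_X_self, mul_add, pderiv_one]
    ring
  rw [lowering_apply, Finset.sum_congr rfl fun j _ => h j, Finset.sum_add_distrib,
    Finset.sum_add_distrib, ← Finset.mul_sum, ← Finset.mul_sum, hp.sum_X_mul_pderiv,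
    ← lowering_apply]
  simp [add_smul, two_mul, Nat.cast_smul_eq_nsmul]
  abel

/-- Let `S v` be the sum on the left. Moving one `lowering` from `H` to `v`, then shifting the
index, gives `0 = S (lowering v) + (M - n - r) S v`. The factor is positive, and `lowering v` has
smaller degree, so induction on `n` applies. -/
theorem sum_descFactorial_mul_lowering_iterate {M r : ℕ} {H : MvPolynomial σ ℝ}
    (hH : H.IsHomogeneous M) (n : ℕ) (hr : r + n < M) (v : MvPolynomial σ ℝ)
    (hv : v.IsHomogeneous n) :
    ∑ i ∈ Finset.range (M + 1), (-1 : ℝ) ^ i * (i.descFactorial r) / i !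
      * factorialFunctional σ ((lowering σ)^[i] H * v) = 0 := by
  have step : ∀ n : ℕ, r + n < M → ∀ v : MvPolynomial σ ℝ, v.IsHomogeneous n →
      (∑ i ∈ Finset.range (M + 1), (-1 : ℝ) ^ i * (i.descFactorial r) / i !
        * factorialFunctional σ ((lowering σ)^[i] H * lowering σ v)) = 0 →
      ∑ i ∈ Finset.range (M + 1), (-1 : ℝ) ^ i * (i.descFactorial r) / i !
        * factorialFunctional σ ((lowering σ)^[i] H * v) = 0 := by
    intro n hn v hv h0
    set w : ℕ → ℝ := fun i => (-1 : ℝ) ^ i * (i.descFactorial r) / i ! with hw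
    set x : ℕ → ℝ := fun i => factorialFunctional σ ((lowering σ)^[i] H * v) with hx
    set y : ℕ → ℝ := fun i => factorialFunctional σ ((lowering σ)^[i] H * lowering σ v) with hy
    have hrec : ∀ i ∈ Finset.range (M + 1), w i * x (i + 1)
        = w i * y i + ((M : ℝ) - i - n) * (w i * x i) := by
      intro i hi
      have := factorialFunctional_lowering_mul_comm (isHomogeneous_lowering_iterate hH i) hv
      rw [← Function.iterate_succ_apply' (lowering σ) i H,
        Nat.cast_sub (Nat.lt_succ_iff.1 (Finset.mem_range.1 hi))] at this
      simp only [hx, hy, this]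
      ring
    have hwi : ∀ i, w i = -(((i + 1 : ℕ) : ℝ) - r) * w (i + 1) := by
      intro i
      have h1 : (((i + 1 : ℕ) : ℝ) - r) * ((i + 1).descFactorial r : ℝ)
          = ((i + 1 : ℕ) : ℝ) * (i.descFactorial r : ℝ) := by
        rcases le_or_gt r (i + 1) with h | h
        · rw [← Nat.cast_sub h]
          exact_mod_cast Nat.succ_descFactorial i r
        · rw [Nat.descFactorial_eq_zero_iff_lt.2 h, Nat.descFactorial_eq_zero_iff_lt.2 (by omega)]
          simp
      have h2 : ((i ! : ℕ) : ℝ) ≠ 0 := by positivity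
      have h3 : ((i + 1 : ℕ) : ℝ) ≠ 0 := by positivity
      simp only [hw]
      rw [Nat.factorial_succ, Nat.cast_mul]
      field_simp
      rw [pow_succ]
      linear_combination -(-1 : ℝ) ^ i * h1
    -- The shifted sum lacks its index-`0` term; this term is zero, through the first factor if `r =
    -- 0` and through `w 0` otherwise. At the other end, `x (M + 1) = 0` for degree reasons.
    have hw0 : (0 - (r : ℝ)) * w 0 = 0 := by
      rcases r with _ | r <;> simp [hw]
    have hshift : ∑ i ∈ Finset.range (M + 1), w i * x (i + 1)
        = -∑ i ∈ Finset.range (M + 1), ((i : ℝ) - r) * (w i * x i) := by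
      have hxM : x (M + 1) = 0 := by simp only [hx, lowering_iterate_eq_zero hH, zero_mul, map_zero]
      rw [Finset.sum_range_succ, hxM, Finset.sum_range_succ', Nat.cast_zero, ← mul_assoc, hw0,
        mul_zero, zero_mul, add_zero, add_zero, ← Finset.sum_neg_distrib]
      refine Finset.sum_congr rfl fun i _ => ?_
      rw [hwi i]
      ring
    have hsum := Finset.sum_congr rfl hrec
    rw [Finset.sum_add_distrib, h0, hshift, zero_add, eq_comm, eq_neg_iff_add_eq_zero,
      ← Finset.sum_add_distrib,
      Finset.sum_congr rfl fun i _ => show ((M : ℝ) - i - n) * (w i * x i) + (i - r) * (w i * x i)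
        = ((M : ℝ) - n - r) * (w i * x i) by ring, ← Finset.mul_sum] at hsum
    refine (mul_eq_zero.1 hsum).resolve_left ?_
    have : (r : ℝ) + n < M := by exact_mod_cast hn
    exact ne_of_gt (by linarith)
  induction n generalizing v with
  | zero => exact step 0 hr v hv (by simp [lowering_of_isHomogeneous_zero hv])
  | succ n ih =>
    exact step (n + 1) hr v hv (ih (by omega) _ (isHomogeneous_lowering hv))

/-- This is the pairing of the lift with `t_k^b v`; the factor `(j + b)!` is the value of the
functional on `t_k^(j+b)`. With `i = j + 1` the weights become, up to sign, `i (i+1) ⋯ (i+b-1) /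
i!`, whose numerator is a polynomial in `i` of degree `b`. The full sum from `i = 0` vanishes, so
the sum sought equals the term `i = 0`. -/
theorem sum_lowering_iterate_varSum_mul {N n b : ℕ} (hb : n + b = N) {g v : MvPolynomial σ ℝ}
    (hg : g.IsHomogeneous N) (hv : v.IsHomogeneous n) :
    ∑ j ∈ Finset.range (N + 1), (-1 : ℝ) ^ j / (j ! * (j + 1)!) * (j + b)!
        * factorialFunctional σ ((lowering σ)^[j + 1] (varSum σ * g) * v)
      = if b = 0 then (2 * N + Fintype.card σ) * factorialFunctional σ (g * v) else 0 := by
  set H := varSum σ * g with hH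
  have hHh : H.IsHomogeneous (N + 1) := by
    rw [add_comm]
    exact isHomogeneous_varSum.mul hg
  have key : ∑ i ∈ Finset.range (N + 2), (-1 : ℝ) ^ i * (b ! * (b - 1 + i).choose b) / i !
      * factorialFunctional σ ((lowering σ)^[i] H * v) = 0 := by
    -- Vandermonde expands the rising factorial in falling factorials of order `r ≤ b`. Since `r + n
    -- ≤ N < N + 1`, the preceding vanishing lemma applies to each. For `b = 0` the truncated `b -
    -- 1` is harmless: the binomial is `1`.
    have h1 : ∀ i : ℕ, ((b ! * (b - 1 + i).choose b : ℕ) : ℝ)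
        = ∑ ij ∈ Finset.HasAntidiagonal.antidiagonal b,
            ((b ! : ℝ) * (b - 1).choose ij.1 / (ij.2)!) * (i.descFactorial ij.2) := by
      intro i
      rw [Nat.add_choose_eq, Nat.cast_mul, Nat.cast_sum, Finset.mul_sum]
      refine Finset.sum_congr rfl fun ij _ => ?_
      rw [Nat.descFactorial_eq_factorial_mul_choose]
      push_cast
      field_simp
    have h2 : ∀ i ∈ Finset.range (N + 2), (-1 : ℝ) ^ i * (b ! * (b - 1 + i).choose b) / i !
        * factorialFunctional σ ((lowering σ)^[i] H * v)
        = ∑ ij ∈ Finset.HasAntidiagonal.antidiagonal b, ((b ! : ℝ) * (b - 1).choose ij.1 / (ij.2)!) *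
          ((-1 : ℝ) ^ i * (i.descFactorial ij.2) / i !
            * factorialFunctional σ ((lowering σ)^[i] H * v)) := by
      intro i _
      rw [← Nat.cast_mul, h1, Finset.mul_sum, Finset.sum_div, Finset.sum_mul]
      refine Finset.sum_congr rfl fun ij _ => ?_
      ring
    rw [Finset.sum_congr rfl h2, Finset.sum_comm]
    refine Finset.sum_eq_zero fun ij hij => ?_
    have : ij.2 ≤ b := (Nat.le_add_left _ _).trans (Finset.HasAntidiagonal.mem_antidiagonal.1 hij).le
    rw [← Finset.mul_sum, sum_descFactorial_mul_lowering_iterate hHh n (by omega) v hv, mul_zero]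
  rw [Finset.sum_range_succ'] at key
  have h3 : ∀ j : ℕ, (-1 : ℝ) ^ (j + 1) * (b ! * (b - 1 + (j + 1)).choose b) / (j + 1)!
      = -((-1 : ℝ) ^ j / (j ! * (j + 1)!) * (j + b)!) := by
    intro j
    have h4 : (b ! * (b - 1 + (j + 1)).choose b) * j ! = (j + b)! := by
      rcases b with _ | b
      · simp
      · rw [show b + 1 - 1 + (j + 1) = b + 1 + j by omega, add_comm j,
          ← Nat.add_choose_mul_factorial_mul_factorial (b + 1) j, Nat.choose_symm_add]
        ring
    rw [← h4]
    push_cast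
    field_simp
    ring
  simp only [h3, neg_mul, Finset.sum_neg_distrib] at key
  rw [neg_add_eq_zero] at key
  rw [key]
  split_ifs with h
  · subst h
    rw [add_zero] at hb
    subst hb
    have := factorialFunctional_varSum_mul (hg.mul hv)
    rw [← mul_assoc] at this
    simp [hH, this, two_mul]
  · simp [Nat.choose_eq_zero_of_lt (show b - 1 < b by omega)]

end FactorialFunctional

/-! ### Trace on a face and the explicit lift. -/

section Face

variable {d : ℕ}

/-- Restriction of a polynomial in barycentric coordinates to the face `t_k = 0`. -/
def faceTrace (k : Fin (d + 1)) : MvPolynomial (Fin (d + 1)) ℝ →ₐ[ℝ] MvPolynomial (Fin d) ℝ :=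
  aeval (k.insertNth (α := fun _ => MvPolynomial (Fin d) ℝ) 0 X)

@[simp]
theorem faceTrace_X_self (k : Fin (d + 1)) : faceTrace k (X k) = 0 := by
  simp [faceTrace]

@[simp]
theorem faceTrace_X_succAbove (k : Fin (d + 1)) (j : Fin d) :
    faceTrace k (X (k.succAbove j)) = X j := by
  simp [faceTrace]

@[simp]
theorem faceTrace_rename (k : Fin (d + 1)) (p : MvPolynomial (Fin d) ℝ) :
    faceTrace k (rename k.succAbove p) = p := by
  have : (faceTrace k).comp (rename k.succAbove) = AlgHom.id ℝ _ := by
    ext j : 1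
    simp
  exact DFunLike.congr_fun this p

theorem isHomogeneous_faceTrace (k : Fin (d + 1)) {n : ℕ} {p : MvPolynomial (Fin (d + 1)) ℝ}
    (hp : p.IsHomogeneous n) : (faceTrace k p).IsHomogeneous n := by
  have h := hp.aeval (n := 1) (k.insertNth (α := fun _ => MvPolynomial (Fin d) ℝ) 0 X)
    fun i => by
      induction i using k.succAboveCases with
      | x => simpa using isHomogeneous_zero _ _ _
      | p j => simpa using isHomogeneous_X ℝ j
  rwa [one_mul] at h

theorem factorialFunctional_X_pow_mul_rename (k : Fin (d + 1)) (a : ℕ)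
    (p : MvPolynomial (Fin d) ℝ) :
    factorialFunctional (Fin (d + 1)) (X k ^ a * rename k.succAbove p)
      = a ! * factorialFunctional (Fin d) p := by
  induction p using MvPolynomial.induction_on' with
  | add p q hp hq => simp only [map_add, mul_add, hp, hq]
  | monomial α r =>
    rw [rename_monomial, X_pow_eq_monomial, monomial_mul, one_mul, factorialFunctional_monomial,
      factorialFunctional_monomial, Fin.prod_univ_succAbove _ k]
    have h1 : Finsupp.mapDomain k.succAbove α k = 0 :=
      Finsupp.mapDomain_of_notMem_range _ _ fun ⟨j, hj⟩ => k.succAbove_ne j hj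
    have h2 : ∀ j, Finsupp.mapDomain k.succAbove α (k.succAbove j) = α j := fun j =>
      Finsupp.mapDomain_apply k.succAbove_right_injective _ _
    simp [h1, h2, Finsupp.single_eq_of_ne (k.succAbove_ne _)]
    ring

/-- The lift of a polynomial on the face `t_k = 0`: up to normalisation, it represents the
`L²`-pairing on the face with respect to the `L²`-pairing on the simplex. -/
def polyLift (k : Fin (d + 1)) (N : ℕ) :
    MvPolynomial (Fin d) ℝ →ₗ[ℝ] MvPolynomial (Fin (d + 1)) ℝ :=
  ∑ j ∈ Finset.range (N + 1), ((-1 : ℝ) ^ j / (j ! * (j + 1)!)) •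
    (LinearMap.mulLeft ℝ (X k ^ j) ∘ₗ (rename k.succAbove).toLinearMap ∘ₗ
      (lowering (Fin d) ^ (j + 1) : Module.End ℝ (MvPolynomial (Fin d) ℝ)) ∘ₗ LinearMap.mulLeft ℝ (varSum (Fin d)))

theorem polyLift_apply (k : Fin (d + 1)) (N : ℕ) (g : MvPolynomial (Fin d) ℝ) :
    polyLift k N g = ∑ j ∈ Finset.range (N + 1), ((-1 : ℝ) ^ j / (j ! * (j + 1)!)) •
      (X k ^ j * rename k.succAbove ((lowering (Fin d))^[j + 1] (varSum (Fin d) * g))) := by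
  simp [polyLift, Module.End.pow_apply]

theorem isHomogeneous_varSum_mul {N : ℕ} {g : MvPolynomial (Fin d) ℝ}
    (hg : g.IsHomogeneous N) : (varSum (Fin d) * g).IsHomogeneous (N + 1) := by
  rw [add_comm]
  exact isHomogeneous_varSum.mul hg

theorem isHomogeneous_polyLift (k : Fin (d + 1)) {N : ℕ} {g : MvPolynomial (Fin d) ℝ}
    (hg : g.IsHomogeneous N) : (polyLift k N g).IsHomogeneous N := by
  rw [polyLift_apply]
  refine IsHomogeneous.sum _ _ _ fun j hj => ?_
  rw [smul_eq_C_mul]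
  refine IsHomogeneous.C_mul ?_ _
  have h := (isHomogeneous_X_pow (R := ℝ) k j).mul
    (IsHomogeneous.rename_isHomogeneous (f := k.succAbove)
      (isHomogeneous_lowering_iterate (isHomogeneous_varSum_mul hg) (j + 1)))
  rwa [Nat.add_sub_add_right, Nat.add_sub_of_le (Nat.lt_succ_iff.1 (Finset.mem_range.1 hj))] at h

theorem faceTrace_polyLift (k : Fin (d + 1)) (N : ℕ) (g : MvPolynomial (Fin d) ℝ) :
    faceTrace k (polyLift k N g) = lowering (Fin d) (varSum (Fin d) * g) := by
  rw [polyLift_apply, map_sum, Finset.sum_eq_single 0]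
  · simp
  · intro j _ hj
    simp [hj]
  · simp

/-- By linearity `V` may be taken as `t_k^b v` with `v` on the face. For `b > 0` the trace of `V` is
zero and for `b = 0` it is `v`, which are the two cases of `sum_lowering_iterate_varSum_mul`. -/
theorem factorialFunctional_polyLift_mul (k : Fin (d + 1)) {N : ℕ} {g : MvPolynomial (Fin d) ℝ}
    (hg : g.IsHomogeneous N) {V : MvPolynomial (Fin (d + 1)) ℝ} (hV : V.IsHomogeneous N) :
    factorialFunctional (Fin (d + 1)) (polyLift k N g * V)
      = (2 * N + d) * factorialFunctional (Fin d) (g * faceTrace k V) := by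
  have key : ∀ (b n : ℕ) (_ : n + b = N) (v : MvPolynomial (Fin d) ℝ) (_ : v.IsHomogeneous n),
      factorialFunctional (Fin (d + 1)) (polyLift k N g * (X k ^ b * rename k.succAbove v))
        = (2 * N + d)
          * factorialFunctional (Fin d) (g * faceTrace k (X k ^ b * rename k.succAbove v)) := by
    intro b n hb v hv
    have h := sum_lowering_iterate_varSum_mul hb hg hv
    have h1 : polyLift k N g * (X k ^ b * rename k.succAbove v)
        = ∑ j ∈ Finset.range (N + 1), ((-1 : ℝ) ^ j / (j ! * (j + 1)!)) • (X k ^ (j + b) *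
            rename k.succAbove ((lowering (Fin d))^[j + 1] (varSum (Fin d) * g) * v)) := by
      rw [polyLift_apply, Finset.sum_mul]
      refine Finset.sum_congr rfl fun j _ => ?_
      rw [smul_mul_assoc, map_mul, pow_add]
      congr 1
      ring
    rw [h1, map_sum]
    simp only [map_smul, factorialFunctional_X_pow_mul_rename, smul_eq_mul, ← mul_assoc]
    rw [h]
    rcases b with _ | b <;> simp
  have hmon : ∀ β ∈ V.support, ∃ b n, n + b = N ∧
      ∃ v : MvPolynomial (Fin d) ℝ, v.IsHomogeneous n ∧
        monomial β (V.coeff β) = X k ^ b * rename k.succAbove v := by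
    intro β hβ
    set β' : Fin d →₀ ℕ := Finsupp.comapDomain k.succAbove β k.succAbove_right_injective.injOn
      with hβ'
    refine ⟨β k, β'.degree, ?_, monomial β' (V.coeff β), isHomogeneous_monomial _ rfl, ?_⟩
    · have h1 : β.degree = N := by
        by_contra h
        exact mem_support_iff.1 hβ (hV.coeff_eq_zero h)
      rw [← h1, Finsupp.degree_eq_sum, Finsupp.degree_eq_sum, Fin.sum_univ_succAbove _ k, add_comm]
      simp [hβ', Finsupp.comapDomain_apply]
    · rw [rename_monomial, X_pow_eq_monomial, monomial_mul, one_mul]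
      congr 2
      refine Finsupp.ext fun i => ?_
      induction i using k.succAboveCases with
      | x =>
        have h1 : Finsupp.mapDomain k.succAbove β' k = 0 :=
          Finsupp.mapDomain_of_notMem_range _ _ fun ⟨j, hj⟩ => k.succAbove_ne j hj
        simp [h1]
      | p j =>
        rw [Finsupp.add_apply, Finsupp.mapDomain_apply k.succAbove_right_injective,
          Finsupp.single_eq_of_ne (k.succAbove_ne _)]
        simp [hβ', Finsupp.comapDomain_apply]
  rw [V.as_sum, map_sum, Finset.mul_sum, Finset.mul_sum, map_sum, map_sum, Finset.mul_sum]
  refine Finset.sum_congr rfl fun β hβ => ?_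
  obtain ⟨b, n, hbn, v, hv, h⟩ := hmon β hβ
  rw [h, key b n hbn v hv]

end Face

/-! ### Bernstein coefficients, elevation as multiplication, and definiteness. -/

section Coefficients

variable {m N : ℕ}

theorem MultiIndex.lt_succ (α : MultiIndex m N) (j : Fin m) : α.1 j < N + 1 := by
  have h : ∑ j, α.1 j = N := by simpa using (Finset.mem_piAntidiag.1 α.2).1
  exact Nat.lt_succ_iff.2 <|
    (Finset.single_le_sum (fun _ _ => Nat.zero_le _) (Finset.mem_univ j)).trans h.le

theorem MultiIndex.sum_eq (α : MultiIndex m N) : ∑ j, α.1 j = N := by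
  simpa using (Finset.mem_piAntidiag.1 α.2).1

/-- The exponent of the monomial in a Bernstein polynomial. -/
def MultiIndex.exponent (α : MultiIndex m N) : Fin m →₀ ℕ := Finsupp.equivFunOnFinite.symm α.1

@[simp]
theorem MultiIndex.exponent_apply (α : MultiIndex m N) (j : Fin m) : α.exponent j = α.1 j := rfl

theorem MultiIndex.exponent_injective : Function.Injective (MultiIndex.exponent (m := m) (N := N)) :=
  fun _ _ h => Subtype.ext (Finsupp.equivFunOnFinite.symm.injective h)

theorem MultiIndex.degree_exponent (α : MultiIndex m N) : α.exponent.degree = N := by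
  rw [Finsupp.degree_eq_sum]
  exact α.sum_eq

theorem MultiIndex.exponent_succ (α : MultiIndex m N) (j : Fin m) :
    (α.succ j).exponent = α.exponent + Finsupp.single j 1 := by
  ext i
  simp [MultiIndex.succ, Finsupp.single_eq_pi_single]

theorem MultiIndex.exists_exponent_eq {β : Fin m →₀ ℕ} (h : β.degree = N) :
    ∃ α : MultiIndex m N, α.exponent = β := by
  refine ⟨⟨β, ?_⟩, by ext; rfl⟩
  rw [Finsupp.degree_eq_sum] at h
  simp [h]

/-- The multinomial coefficient of a Bernstein polynomial. -/
def multinomialCoeff (α : MultiIndex m N) : ℝ := (N ! : ℝ) / ∏ j, ((α.1 j)! : ℝ)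

theorem multinomialCoeff_ne_zero (α : MultiIndex m N) : multinomialCoeff α ≠ 0 := by
  unfold multinomialCoeff
  positivity

/-- The Bernstein polynomials as homogeneous polynomials in the barycentric coordinates. -/
def bernsteinPoly (α : MultiIndex m N) : MvPolynomial (Fin m) ℝ :=
  monomial α.exponent (multinomialCoeff α)

theorem eval_bernsteinPoly (α : MultiIndex m N) (t : Fin m → ℝ) :
    eval t (bernsteinPoly α) = bernstein α t := by
  rw [bernsteinPoly, eval_monomial, Finsupp.prod_fintype _ _ fun _ => pow_zero _]
  rfl

theorem isHomogeneous_bernsteinPoly (α : MultiIndex m N) : (bernsteinPoly α).IsHomogeneous N :=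
  isHomogeneous_monomial _ α.degree_exponent

/-- The polynomial with given Bernstein coefficients. -/
def toPoly (m N : ℕ) : (MultiIndex m N → ℝ) →ₗ[ℝ] MvPolynomial (Fin m) ℝ :=
  Fintype.linearCombination ℝ bernsteinPoly

theorem toPoly_apply (u : MultiIndex m N → ℝ) : toPoly m N u = ∑ α, u α • bernsteinPoly α := rfl

theorem isHomogeneous_toPoly (u : MultiIndex m N → ℝ) : (toPoly m N u).IsHomogeneous N :=
  IsHomogeneous.sum _ _ _ fun α _ => by
    rw [smul_eq_C_mul]
    exact (isHomogeneous_bernsteinPoly α).C_mul _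

theorem coeff_toPoly (u : MultiIndex m N → ℝ) (α : MultiIndex m N) :
    (toPoly m N u).coeff α.exponent = u α * multinomialCoeff α := by
  classical
  rw [toPoly_apply, coeff_sum, Finset.sum_eq_single α]
  · simp [bernsteinPoly]
  · intro β _ hβ
    rw [coeff_smul, bernsteinPoly, coeff_monomial, if_neg fun h => hβ (MultiIndex.exponent_injective h),
      smul_zero]
  · simp

/-- The Bernstein coefficients of the degree `N` part of a polynomial. -/
def ofPoly (m N : ℕ) : MvPolynomial (Fin m) ℝ →ₗ[ℝ] (MultiIndex m N → ℝ) :=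
  LinearMap.pi fun α => (multinomialCoeff α)⁻¹ • lcoeff ℝ α.exponent

theorem ofPoly_apply (p : MvPolynomial (Fin m) ℝ) (α : MultiIndex m N) :
    ofPoly m N p α = (multinomialCoeff α)⁻¹ * p.coeff α.exponent := rfl

@[simp]
theorem ofPoly_toPoly (u : MultiIndex m N → ℝ) : ofPoly m N (toPoly m N u) = u := by
  ext α
  rw [ofPoly_apply, coeff_toPoly]
  field_simp [multinomialCoeff_ne_zero α]

theorem toPoly_ofPoly {p : MvPolynomial (Fin m) ℝ} (hp : p.IsHomogeneous N) :
    toPoly m N (ofPoly m N p) = p := by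
  ext β
  by_cases h : β.degree = N
  · obtain ⟨α, rfl⟩ := MultiIndex.exists_exponent_eq h
    rw [coeff_toPoly, ofPoly_apply]
    field_simp [multinomialCoeff_ne_zero α]
  · rw [hp.coeff_eq_zero h, (isHomogeneous_toPoly _).coeff_eq_zero h]

theorem toPoly_injective : Function.Injective (toPoly m N) :=
  Function.LeftInverse.injective ofPoly_toPoly

theorem factorialFunctional_toPoly_mul_toPoly {m₁ : ℕ}
    (F : MvPolynomial (Fin m) ℝ →ₐ[ℝ] MvPolynomial (Fin m₁) ℝ) (u v : MultiIndex m N → ℝ) :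
    factorialFunctional (Fin m₁) (F (toPoly m N u) * F (toPoly m N v))
      = ∑ α, ∑ β, u α * v β
          * factorialFunctional (Fin m₁) (F (bernsteinPoly α * bernsteinPoly β)) := by
  rw [toPoly_apply, toPoly_apply, map_sum, map_sum, Finset.sum_mul_sum, map_sum]
  simp only [map_sum, map_smul, smul_mul_smul_comm, map_mul, smul_eq_mul]

theorem X_mul_bernsteinPoly (α : MultiIndex m N) (j : Fin m) :
    X j * bernsteinPoly α = (((α.1 j : ℝ) + 1) / ((N : ℝ) + 1)) • bernsteinPoly (α.succ j) := by
  rw [bernsteinPoly, bernsteinPoly, X, monomial_mul, one_mul, smul_monomial, add_comm,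
    ← MultiIndex.exponent_succ]
  congr 1
  have h : ∏ i, (((α.succ j).1 i)! : ℝ) = ((α.1 j : ℝ) + 1) * ∏ i, ((α.1 i)! : ℝ) := by
    rw [← Finset.mul_prod_erase _ _ (Finset.mem_univ j),
      ← Finset.mul_prod_erase (f := fun i => ((α.1 i)! : ℝ)) _ (Finset.mem_univ j), ← mul_assoc]
    congr 1
    · simp [MultiIndex.succ, Nat.factorial_succ]
    · refine Finset.prod_congr rfl fun i hi => ?_
      simp [MultiIndex.succ, Pi.single_eq_of_ne (Finset.ne_of_mem_erase hi)]
  have h1 : (α.1 j : ℝ) + 1 ≠ 0 := by positivity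
  have h2 : ∏ i, ((α.1 i)! : ℝ) ≠ 0 := by positivity
  rw [multinomialCoeff, multinomialCoeff, h, Nat.factorial_succ, smul_eq_mul]
  push_cast
  field_simp

theorem elevation_apply (β : MultiIndex m (N + 1)) (α : MultiIndex m N) :
    elevation m N β α
      = ∑ j : Fin m, if β = α.succ j then ((α.1 j : ℝ) + 1) / ((N : ℝ) + 1) else 0 := by
  simp only [elevation, Matrix.of_apply, Subtype.ext_iff, MultiIndex.succ]

theorem toPoly_elevation_mulVec (u : MultiIndex m N → ℝ) :
    toPoly m (N + 1) (elevation m N *ᵥ u) = varSum (Fin m) * toPoly m N u := by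
  have h : ∀ α : MultiIndex m N, varSum (Fin m) * bernsteinPoly α
      = ∑ β, elevation m N β α • bernsteinPoly β := by
    intro α
    simp only [varSum, Finset.sum_mul, X_mul_bernsteinPoly, elevation_apply, Finset.sum_smul]
    rw [Finset.sum_comm]
    refine Finset.sum_congr rfl fun j _ => ?_
    simp [ite_smul]
  rw [toPoly_apply, toPoly_apply, Finset.mul_sum]
  simp only [mul_smul_comm, h, Matrix.mulVec, dotProduct, Finset.smul_sum, Finset.sum_smul,
    smul_smul]
  rw [Finset.sum_comm]
  simp only [mul_comm]

theorem coeff_lowering (p : MvPolynomial (Fin m) ℝ) (β : Fin m →₀ ℕ) :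
    (lowering (Fin m) p).coeff β
      = ∑ j, ((β j : ℝ) + 1) ^ 2 * p.coeff (β + Finsupp.single j 1) := by
  rw [lowering_apply, coeff_sum]
  refine Finset.sum_congr rfl fun j _ => ?_
  rw [coeff_pderiv, add_comm β, coeff_X_mul, coeff_pderiv, add_comm]
  ring

/-- On monomial coefficients `lowering` carries the weight `(α_j + 1)^2`. One factor `α_j + 1` is
absorbed by the ratio of the multinomial coefficients of `α + e_j` and `α`; the other is the entry
of the elevation matrix. -/
theorem lowering_toPoly (v : MultiIndex m (N + 1) → ℝ) :
    lowering (Fin m) (toPoly m (N + 1) v)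
      = ((N : ℝ) + 1) ^ 2 • toPoly m N ((elevation m N)ᵀ *ᵥ v) := by
  rw [← map_smul]
  refine (toPoly_ofPoly (isHomogeneous_lowering (isHomogeneous_toPoly v))).symm.trans
    (congrArg _ ?_)
  refine funext fun α : MultiIndex m N => ?_
  have h : ((elevation m N)ᵀ *ᵥ v) α
      = ∑ j, ((α.1 j : ℝ) + 1) / ((N : ℝ) + 1) * v (α.succ j) := by
    simp only [Matrix.mulVec, dotProduct, Matrix.transpose_apply, elevation_apply, Finset.sum_mul]
    rw [Finset.sum_comm]
    refine Finset.sum_congr rfl fun j _ => ?_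
    simp [ite_mul]
  have h1 : ∀ j, multinomialCoeff (α.succ j) * ((α.1 j : ℝ) + 1)
      = ((N : ℝ) + 1) * multinomialCoeff α := by
    intro j
    have := congrArg (coeff (α.succ j).exponent) (X_mul_bernsteinPoly α j)
    rw [MultiIndex.exponent_succ, add_comm, coeff_X_mul, add_comm, ← MultiIndex.exponent_succ,
      bernsteinPoly, coeff_monomial, if_pos rfl, coeff_smul, bernsteinPoly, coeff_monomial,
      if_pos rfl, smul_eq_mul] at this
    rw [this]
    have : (N : ℝ) + 1 ≠ 0 := by positivity
    field_simp
  change ofPoly m N _ α = _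
  rw [Pi.smul_apply, h, ofPoly_apply, coeff_lowering, Finset.mul_sum, smul_eq_mul, Finset.mul_sum]
  refine Finset.sum_congr rfl fun j _ => ?_
  rw [← MultiIndex.exponent_succ, coeff_toPoly, MultiIndex.exponent_apply]
  have h2 : (N : ℝ) + 1 ≠ 0 := by positivity
  have h3 := multinomialCoeff_ne_zero α
  field_simp
  linear_combination v (α.succ j) * (h1 j)

theorem toPoly_liftZero_mulVec (u : MultiIndex m N → ℝ) :
    toPoly m N (liftZero m N *ᵥ u)
      = (1 / 2 : ℝ) • lowering (Fin m) (varSum (Fin m) * toPoly m N u) := by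
  rw [← toPoly_elevation_mulVec, lowering_toPoly, liftZero, Matrix.smul_mulVec, map_smul,
    ← Matrix.mulVec_mulVec, smul_smul]
  congr 1
  ring

theorem choose_add_eq_sum {a K : ℕ} (b : ℕ) (h : a < K) :
    (a + b).choose a = ∑ c ∈ Finset.range K, a.choose c * b.choose c := by
  rw [Nat.add_choose_eq, Finset.Nat.sum_antidiagonal_eq_sum_range_succ_mk,
    ← Finset.sum_range_reflect,
    ← Finset.sum_subset (Finset.range_subset_range.2 (show a.succ ≤ K from h))]
  · refine Finset.sum_congr rfl fun c hc => ?_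
    have : c ≤ a := Nat.lt_succ_iff.1 (Finset.mem_range.1 hc)
    have h1 : a + 1 - 1 - c = a - c := by omega
    simp only [Nat.succ_eq_add_one, h1, Nat.choose_symm this, Nat.sub_sub_self this]
  · intro c _ hc
    rw [Nat.choose_eq_zero_of_lt (by simpa using hc), zero_mul]

/-- The pairing is `N!^2 ∏ (α_j + β_j).choose α_j`. Vandermonde in each coordinate factors this as
`P Pᵀ` with `P α γ = ∏ (α_j).choose (γ_j)`, which exhibits the form as a sum of squares. -/
theorem factorialFunctional_bernsteinPoly_mul (α β : MultiIndex m N) :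
    factorialFunctional (Fin m) (bernsteinPoly α * bernsteinPoly β)
      = (N ! : ℝ) ^ 2 * ∑ γ ∈ Fintype.piFinset fun _ : Fin m => Finset.range (N + 1),
          (∏ j, ((α.1 j).choose (γ j) : ℝ)) * ∏ j, ((β.1 j).choose (γ j) : ℝ) := by
  have h : ∏ j, (((α.1 j + β.1 j).choose (α.1 j) : ℕ) : ℝ)
      = ∑ γ ∈ Fintype.piFinset fun _ : Fin m => Finset.range (N + 1),
          (∏ j, ((α.1 j).choose (γ j) : ℝ)) * ∏ j, ((β.1 j).choose (γ j) : ℝ) := by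
    simp only [← Finset.prod_mul_distrib]
    rw [Finset.sum_prod_piFinset (Finset.range (N + 1)) fun j c =>
      (((α.1 j).choose c : ℝ) * ((β.1 j).choose c : ℝ))]
    refine Finset.prod_congr rfl fun j _ => ?_
    rw [choose_add_eq_sum _ (α.lt_succ j)]
    push_cast
    rfl
  rw [← h, bernsteinPoly, bernsteinPoly, monomial_mul, factorialFunctional_monomial,
    multinomialCoeff, multinomialCoeff, div_mul_div_comm, ← Finset.prod_mul_distrib, div_mul_eq_mul_div,
    mul_div_assoc, ← Finset.prod_div_distrib, sq]
  congr 1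
  refine Finset.prod_congr rfl fun j _ => ?_
  rw [Nat.choose_symm_add, Nat.add_choose, Nat.cast_div (Nat.factorial_mul_factorial_dvd_factorial_add _ _) (by positivity)]
  push_cast
  rfl

theorem eq_zero_of_factorialFunctional_toPoly_mul_self {u : MultiIndex m N → ℝ}
    (h : factorialFunctional (Fin m) (toPoly m N u * toPoly m N u) = 0) : u = 0 := by
  have h1 : factorialFunctional (Fin m) (toPoly m N u * toPoly m N u)
      = (N ! : ℝ) ^ 2 * ∑ γ ∈ Fintype.piFinset fun _ : Fin m => Finset.range (N + 1),
          (∑ α, u α * ∏ j, ((α.1 j).choose (γ j) : ℝ)) ^ 2 := by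
    have h2 := factorialFunctional_toPoly_mul_toPoly (AlgHom.id ℝ _) u u
    simp only [AlgHom.coe_id, id, factorialFunctional_bernsteinPoly_mul] at h2
    rw [h2]
    have h3 : ∀ γ : Fin m → ℕ, (∑ α : MultiIndex m N, u α * ∏ j, ((α.1 j).choose (γ j) : ℝ)) ^ 2
        = ∑ α : MultiIndex m N, ∑ β : MultiIndex m N, u α * u β *
          ((∏ j, ((α.1 j).choose (γ j) : ℝ)) * ∏ j, ((β.1 j).choose (γ j) : ℝ)) := fun γ => by
      rw [sq, Finset.sum_mul_sum]
      exact Finset.sum_congr rfl fun α _ => Finset.sum_congr rfl fun β _ => by ring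
    simp only [h3]
    conv_rhs => rw [Finset.sum_comm, Finset.mul_sum]
    refine Finset.sum_congr rfl fun α _ => ?_
    conv_rhs => rw [Finset.sum_comm, Finset.mul_sum]
    refine Finset.sum_congr rfl fun β _ => ?_
    rw [← Finset.mul_sum]
    ring
  rw [h1, mul_eq_zero, or_iff_right (by positivity), Finset.sum_eq_zero_iff_of_nonneg
    fun _ _ => sq_nonneg _] at h
  ext β
  -- In the square with `γ = β`, a nonzero product needs `β ≤ α` coordinatewise, and equal total
  -- degrees then force `α = β`. Thus only `u β` remains.
  have h2 := pow_eq_zero_iff two_ne_zero |>.1 <| h β.1 <| by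
    rw [Fintype.mem_piFinset]
    exact fun j => Finset.mem_range.2 (β.lt_succ j)
  rw [Finset.sum_eq_single β] at h2
  · simpa using h2
  · intro α _ hα
    have : ∃ j, α.1 j < β.1 j := by
      by_contra! hle
      refine hα (Subtype.ext (funext fun j => ?_))
      exact (((Finset.sum_eq_sum_iff_of_le fun j _ => hle j).1
        (β.sum_eq.trans α.sum_eq.symm)) j (Finset.mem_univ j)).symm
    obtain ⟨j, hj⟩ := this
    rw [Finset.prod_eq_zero (Finset.mem_univ j) (by rw [Nat.choose_eq_zero_of_lt hj, Nat.cast_zero]),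
      mul_zero]
  · simp

end Coefficients

/-! ### Dirichlet integrals and the mass matrix. -/

theorem integral_pow_mul_sub_pow (a b : ℕ) (c : ℝ) :
    ∫ x in (0 : ℝ)..c, x ^ a * (c - x) ^ b = a ! * b ! / (a + b + 1)! * c ^ (a + b + 1) := by
  induction b generalizing a with
  | zero =>
    simp only [pow_zero, mul_one, integral_pow, Nat.factorial_succ, add_zero]
    push_cast
    field_simp
    simp
  | succ b ih =>
    have hd : ∀ x ∈ Set.uIcc 0 c, HasDerivAt (fun x : ℝ => x ^ (a + 1) * (c - x) ^ (b + 1))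
        ((a + 1) * (x ^ a * (c - x) ^ (b + 1)) - (b + 1) * (x ^ (a + 1) * (c - x) ^ b)) x := by
      intro x _
      have h := (hasDerivAt_pow (a + 1) x).mul (((hasDerivAt_id x).const_sub c).pow (b + 1))
      refine h.congr_deriv ?_
      simp
      ring
    have h := intervalIntegral.integral_eq_sub_of_hasDerivAt hd
      (by apply Continuous.intervalIntegrable; fun_prop)
    rw [intervalIntegral.integral_sub (by apply Continuous.intervalIntegrable; fun_prop)
      (by apply Continuous.intervalIntegrable; fun_prop), intervalIntegral.integral_const_mul,
      intervalIntegral.integral_const_mul, ih] at h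
    simp only [sub_self, zero_pow (Nat.succ_ne_zero _), mul_zero, zero_mul] at h
    have h1 : (a : ℝ) + 1 ≠ 0 := by positivity
    have h2 : a + 1 + b + 1 = a + (b + 1) + 1 := by ring
    have h3 := sub_eq_zero.1 h
    rw [h2, Nat.factorial_succ a] at h3
    rw [Nat.factorial_succ b]
    push_cast at h3 ⊢
    refine mul_left_cancel₀ h1 (h3.trans ?_)
    ring

/-- The corner `{y ≥ 0, ∑ j, y j ≤ c}` of the positive orthant. -/
def corner (n : ℕ) (c : ℝ) : Set (Fin n → ℝ) := {y | (∀ j, 0 ≤ y j) ∧ ∑ j, y j ≤ c}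

theorem isClosed_corner (n : ℕ) (c : ℝ) : IsClosed (corner n c) := by
  refine IsClosed.inter (s₁ := {y : Fin n → ℝ | ∀ j, 0 ≤ y j}) (s₂ := {y | ∑ j, y j ≤ c}) ?_ ?_
  · rw [Set.ofPred_forall]
    exact isClosed_iInter fun j => isClosed_le continuous_const (continuous_apply j)
  · exact isClosed_le (by fun_prop) continuous_const

theorem isCompact_corner (n : ℕ) (c : ℝ) : IsCompact (corner n c) := by
  refine (isCompact_Icc (a := (0 : Fin n → ℝ)) (b := fun _ => c)).of_isClosed_subset
    (isClosed_corner n c) fun y hy => ⟨fun j => hy.1 j, fun j => ?_⟩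
  exact (Finset.single_le_sum (fun i _ => hy.1 i) (Finset.mem_univ j)).trans hy.2

theorem cons_mem_corner_iff {n : ℕ} {c : ℝ} (x : ℝ) (y : Fin n → ℝ) :
    (Fin.cons x y : Fin (n + 1) → ℝ) ∈ corner (n + 1) c ↔ 0 ≤ x ∧ y ∈ corner n (c - x) := by
  simp only [corner, Set.mem_ofPred_eq, Fin.forall_fin_succ, Fin.cons_zero, Fin.cons_succ,
    Fin.sum_univ_succ, and_assoc, le_sub_iff_add_le']

/-- Fubini in the first coordinate `x` leaves a corner of size `c - x`, hence the general `c`; the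
outer integral is then a beta integral. The factor with exponent `a` plays the role of `t_0`. -/
theorem integral_corner {n : ℕ} (α : Fin n → ℕ) (a : ℕ) {c : ℝ} (hc : 0 ≤ c) :
    ∫ y in corner n c, (∏ j, y j ^ α j) * (c - ∑ j, y j) ^ a
      = a ! * (∏ j, ((α j)! : ℝ)) / (∑ j, α j + a + n)! * c ^ (∑ j, α j + a + n) := by
  induction n generalizing c with
  | zero =>
    have h : corner 0 c = Set.univ := Set.eq_univ_of_forall fun y => by simp [corner, hc]
    have h1 : (a ! : ℝ) ≠ 0 := by positivity
    simp [h, h1, integral_const, measureReal_def, volume_pi]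
  | succ n ih =>
    set f : (Fin (n + 1) → ℝ) → ℝ := fun y => (∏ j, y j ^ α j) * (c - ∑ j, y j) ^ a with hf
    have hfc : Continuous f := by fun_prop
    have hint : Integrable ((corner (n + 1) c).indicator f) :=
      (integrable_indicator_iff (isClosed_corner _ c).measurableSet).2
        (hfc.continuousOn.integrableOn_compact (isCompact_corner _ c))
    have hmp := (volume_preserving_piFinSuccAbove (fun _ : Fin (n + 1) => ℝ) 0).symm
    have hsym : ∀ z : ℝ × (Fin n → ℝ),
        (MeasurableEquiv.piFinSuccAbove (fun _ : Fin (n + 1) => ℝ) 0).symm z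
          = (Fin.cons z.1 z.2 : Fin (n + 1) → ℝ) := fun z => by
      simp [MeasurableEquiv.piFinSuccAbove]
      rfl
    have hint2 := (hmp.integrable_comp_emb (MeasurableEquiv.measurableEmbedding _)).2 hint
    rw [← integral_indicator (isClosed_corner _ c).measurableSet,
      ← hmp.integral_comp (MeasurableEquiv.measurableEmbedding _), Measure.volume_eq_prod,
      integral_prod (fun z => (corner (n + 1) c).indicator f
        ((MeasurableEquiv.piFinSuccAbove (fun _ : Fin (n + 1) => ℝ) 0).symm z)) hint2]
    have hinner : ∀ x : ℝ, (∫ y : Fin n → ℝ, (corner (n + 1) c).indicator f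
          ((MeasurableEquiv.piFinSuccAbove (fun _ : Fin (n + 1) => ℝ) 0).symm (x, y)))
        = (Set.Icc 0 c).indicator (fun x => a ! * (∏ j : Fin n, ((α j.succ)! : ℝ))
            / (∑ j : Fin n, α j.succ + a + n)!
            * (x ^ α 0 * (c - x) ^ (∑ j : Fin n, α j.succ + a + n))) x := by
      intro x
      simp only [hsym]
      by_cases hx : x ∈ Set.Icc 0 c
      · rw [Set.indicator_of_mem hx]
        have h1 : ∀ y : Fin n → ℝ, (corner (n + 1) c).indicator f (Fin.cons x y)
            = (corner n (c - x)).indicator (fun y => x ^ α 0 *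
              ((∏ j, y j ^ α j.succ) * ((c - x) - ∑ j, y j) ^ a)) y := by
          intro y
          by_cases hy : y ∈ corner n (c - x)
          · rw [Set.indicator_of_mem hy,
              Set.indicator_of_mem ((cons_mem_corner_iff x y).2 ⟨hx.1, hy⟩)]
            simp [hf, Fin.prod_univ_succ, Fin.sum_univ_succ, mul_assoc, sub_sub]
          · rw [Set.indicator_of_notMem hy, Set.indicator_of_notMem
              fun h => hy ((cons_mem_corner_iff x y).1 h).2]
        simp only [h1]
        rw [integral_indicator (isClosed_corner _ _).measurableSet, integral_const_mul,
          ih _ (sub_nonneg.2 hx.2)]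
        ring
      · rw [Set.indicator_of_notMem hx]
        refine integral_eq_zero_of_ae (Filter.Eventually.of_forall fun y => ?_)
        refine Set.indicator_of_notMem (fun h => hx ?_) _
        rw [cons_mem_corner_iff] at h
        have h2 : 0 ≤ ∑ j, y j := Finset.sum_nonneg fun j _ => h.2.1 j
        exact ⟨h.1, by linarith [h.2.2]⟩
    simp only [hinner]
    rw [integral_indicator measurableSet_Icc, integral_const_mul, integral_Icc_eq_integral_Ioc,
      ← intervalIntegral.integral_of_le hc, integral_pow_mul_sub_pow, Fin.prod_univ_succ,
      Fin.sum_univ_succ, show α 0 + (∑ j : Fin n, α j.succ + a + n) + 1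
        = α 0 + ∑ j : Fin n, α j.succ + a + (n + 1) by ring]
    field_simp

theorem isClosed_refSimplex (n : ℕ) : IsClosed (refSimplex n) := by
  refine IsClosed.inter (s₁ := {y : EuclideanSpace ℝ (Fin n) | ∀ j, -1 ≤ y j})
    (s₂ := {y | ∑ j, y j ≤ 2 - (n : ℝ)}) ?_ ?_
  · rw [Set.ofPred_forall]
    exact isClosed_iInter fun j => isClosed_le continuous_const (by fun_prop)
  · exact isClosed_le (by fun_prop) continuous_const

theorem continuous_bary (n : ℕ) : Continuous (bary (d := n)) := by
  refine continuous_pi fun k => ?_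
  induction k using Fin.cases with
  | zero => simp only [bary, Fin.cons_zero]; fun_prop
  | succ j => simp only [bary, Fin.cons_succ]; fun_prop

theorem integral_refSimplex_prod {n : ℕ} (α : Fin (n + 1) → ℕ) :
    ∫ x in refSimplex n, ∏ k, bary x k ^ α k
      = 2 ^ n / (∑ k, α k + n)! * ∏ k, ((α k)! : ℝ) := by
  set g : (Fin n → ℝ) → ℝ := (corner n 1).indicator
    fun y => (∏ j, y j ^ α j.succ) * (1 - ∑ j, y j) ^ α 0 with hg
  have h1 : ∀ x : EuclideanSpace ℝ (Fin n), (refSimplex n).indicator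
      (fun x => ∏ k, bary x k ^ α k) x = g ((2 : ℝ)⁻¹ • (WithLp.ofLp x + 1)) := by
    intro x
    have h2 : ∀ j, ((2 : ℝ)⁻¹ • (WithLp.ofLp x + 1)) j = bary x j.succ := fun j => by
      simp [bary]; ring
    have h3 : 1 - ∑ j, ((2 : ℝ)⁻¹ • (WithLp.ofLp x + 1)) j = bary x 0 := by
      simp only [h2]
      rw [← sum_bary x, Fin.sum_univ_succ, add_sub_cancel_right]
    have h4 : ((2 : ℝ)⁻¹ • (WithLp.ofLp x + 1)) ∈ corner n 1 ↔ x ∈ refSimplex n := by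
      rw [mem_refSimplex_iff, Fin.forall_fin_succ, ← h3, sub_nonneg, and_comm]
      simp only [corner, Set.mem_ofPred_eq, h2]
    by_cases hx : x ∈ refSimplex n
    · rw [Set.indicator_of_mem hx, hg, Set.indicator_of_mem (h4.2 hx)]
      beta_reduce
      rw [h3]
      simp only [h2]
      rw [Fin.prod_univ_succ, mul_comm]
    · rw [Set.indicator_of_notMem hx, hg, Set.indicator_of_notMem fun h => hx (h4.1 h)]
  rw [← integral_indicator (isClosed_refSimplex n).measurableSet]
  simp only [h1]
  rw [(PiLp.volume_preserving_ofLp (Fin n)).integral_comp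
      (MeasurableEquiv.toLp 2 (Fin n → ℝ)).symm.measurableEmbedding
      (fun y : Fin n → ℝ => g ((2 : ℝ)⁻¹ • (y + 1))),
    integral_add_right_eq_self (fun y : Fin n → ℝ => g ((2 : ℝ)⁻¹ • y)),
    Measure.integral_comp_inv_smul, hg, integral_indicator (isClosed_corner _ _).measurableSet,
    integral_corner _ _ zero_le_one, Fin.prod_univ_succ, Fin.sum_univ_succ,
    add_comm (α 0)]
  simp
  ring

theorem integral_refSimplex_eval {n N : ℕ} {p : MvPolynomial (Fin (n + 1)) ℝ}
    (hp : p.IsHomogeneous N) :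
    ∫ x in refSimplex n, eval (bary x) p
      = 2 ^ n / (N + n)! * factorialFunctional (Fin (n + 1)) p := by
  have hcomp : IsCompact (refSimplex n) := by
    refine Metric.isCompact_of_isClosed_isBounded (isClosed_refSimplex n) ?_
    have h : refSimplex n ⊆ WithLp.ofLp ⁻¹' Set.Icc (fun _ => (-1 : ℝ)) (fun _ => 1) := by
      intro x hx
      rw [mem_refSimplex_iff] at hx
      refine ⟨fun j => ?_, fun j => ?_⟩
      · have := hx j.succ
        simp only [bary, Fin.cons_succ] at this
        linarith
      · have h1 := Finset.single_le_sum (fun k _ => hx k) (Finset.mem_univ j.succ)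
        rw [sum_bary] at h1
        simp only [bary, Fin.cons_succ] at h1
        linarith
    refine Bornology.IsBounded.subset ?_ h
    exact ((EuclideanSpace.equiv (Fin n) ℝ).toHomeomorph.isCompact_preimage.2
      isCompact_Icc).isBounded
  have hexp : ∀ x : EuclideanSpace ℝ (Fin n), eval (bary x) p
      = ∑ β ∈ p.support, p.coeff β * ∏ k, bary x k ^ β k := fun x => eval_eq' _ _
  simp only [hexp]
  rw [integral_finsetSum]
  · conv_rhs => rw [p.as_sum, map_sum, Finset.mul_sum]
    refine Finset.sum_congr rfl fun β hβ => ?_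
    have h1 : ∑ k, β k = N := by
      rw [← Finsupp.degree_eq_sum]
      by_contra h
      exact mem_support_iff.1 hβ (hp.coeff_eq_zero h)
    rw [integral_const_mul, integral_refSimplex_prod, h1, factorialFunctional_monomial]
    ring
  · intro β _
    refine ContinuousOn.integrableOn_compact hcomp (Continuous.continuousOn ?_)
    refine continuous_const.mul (continuous_finsetProd _ fun k _ => Continuous.pow ?_ _)
    exact (continuous_apply k).comp (continuous_bary n)

theorem massMatrix_apply {d N : ℕ} (α β : MultiIndex (d + 1) N) :
    massMatrix d N α β = 2 ^ d / (2 * N + d)!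
      * factorialFunctional (Fin (d + 1)) (bernsteinPoly β * bernsteinPoly α) := by
  rw [two_mul, ← integral_refSimplex_eval
    ((isHomogeneous_bernsteinPoly β).mul (isHomogeneous_bernsteinPoly α))]
  simp only [map_mul, eval_bernsteinPoly]
  rfl

/-! ### Affine parametrization of the faces and surface measure. -/

/-- The point of the affine hull of the reference simplex with given barycentric coordinates. -/
def ofBary {d : ℕ} (t : Fin (d + 1) → ℝ) : EuclideanSpace ℝ (Fin d) :=
  WithLp.toLp 2 fun j => 2 * t j.succ - 1

theorem bary_ofBary {d : ℕ} {t : Fin (d + 1) → ℝ} (ht : ∑ k, t k = 1) : bary (ofBary t) = t := by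
  have h : ∀ j, (1 + (ofBary t) j) / 2 = t j.succ := fun j => by simp [ofBary]
  ext k
  induction k using Fin.cases with
  | zero =>
    simp only [bary, Fin.cons_zero, h]
    rw [← ht, Fin.sum_univ_succ, add_sub_cancel_right]
  | succ j => simp only [bary, Fin.cons_succ, h]

theorem ofBary_bary {d : ℕ} (x : EuclideanSpace ℝ (Fin d)) : ofBary (bary x) = x := by
  ext j
  simp [ofBary, bary]
  ring

/-- The parametrization of the face `t_k = 0` by a reference simplex. -/
def faceParam {n : ℕ} (k : Fin (n + 2)) (y : EuclideanSpace ℝ (Fin n)) :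
    EuclideanSpace ℝ (Fin (n + 1)) :=
  ofBary (k.insertNth (α := fun _ => ℝ) 0 (bary y))

theorem bary_faceParam {n : ℕ} (k : Fin (n + 2)) (y : EuclideanSpace ℝ (Fin n)) :
    bary (faceParam k y) = k.insertNth (α := fun _ => ℝ) 0 (bary y) :=
  bary_ofBary (by simp [Fin.sum_univ_succAbove _ k, sum_bary])

theorem refFace_eq_image {n : ℕ} (k : Fin (n + 2)) :
    refFace (n + 1) k = faceParam k '' refSimplex n := by
  ext x
  simp only [refFace, Set.mem_ofPred_eq, Set.mem_image, mem_refSimplex_iff]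
  constructor
  · rintro ⟨h1, h2⟩
    have h3 : ∑ j, bary x (k.succAbove j) = 1 := by
      rw [← sum_bary x, Fin.sum_univ_succAbove _ k, h2, zero_add]
    refine ⟨ofBary fun j => bary x (k.succAbove j), fun j => ?_, ?_⟩
    · rw [bary_ofBary h3]
      exact h1 _
    · rw [faceParam, bary_ofBary h3, ← h2]
      conv_rhs => rw [← ofBary_bary x]
      congr 1
      exact Fin.insertNth_self_removeNth k (bary x)
  · rintro ⟨y, hy, rfl⟩
    rw [bary_faceParam]
    refine ⟨fun i => ?_, by simp⟩
    induction i using k.succAboveCases with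
    | x => simp
    | p j => simpa using hy j

/-- The linear part of `faceParam k`. -/
def faceLinear {n : ℕ} (k : Fin (n + 2)) :
    EuclideanSpace ℝ (Fin n) →ₗ[ℝ] EuclideanSpace ℝ (Fin (n + 1)) where
  toFun y := WithLp.toLp 2 fun j => k.insertNth (α := fun _ => ℝ) 0
    (Fin.cons (-∑ i, y i) fun i => y i : Fin (n + 1) → ℝ) j.succ
  map_add' y z := by
    ext j
    have h : ∀ i, k.insertNth (α := fun _ => ℝ) 0
        (Fin.cons (-∑ i, (y + z) i) fun i => (y + z) i : Fin (n + 1) → ℝ) i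
        = k.insertNth (α := fun _ => ℝ) 0
          (Fin.cons (-∑ i, y i) fun i => y i : Fin (n + 1) → ℝ) i
        + k.insertNth (α := fun _ => ℝ) 0
          (Fin.cons (-∑ i, z i) fun i => z i : Fin (n + 1) → ℝ) i := by
      intro i
      induction i using k.succAboveCases with
      | x => simp
      | p j => induction j using Fin.cases <;> simp [Finset.sum_add_distrib, add_comm]
    exact h j.succ
  map_smul' c y := by
    ext j
    have h : ∀ i, k.insertNth (α := fun _ => ℝ) 0
        (Fin.cons (-∑ i, (c • y) i) fun i => (c • y) i : Fin (n + 1) → ℝ) i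
        = c * k.insertNth (α := fun _ => ℝ) 0
          (Fin.cons (-∑ i, y i) fun i => y i : Fin (n + 1) → ℝ) i := by
      intro i
      induction i using k.succAboveCases with
      | x => simp
      | p j => induction j using Fin.cases <;> simp [Finset.mul_sum]
    exact h j.succ

theorem faceParam_eq {n : ℕ} (k : Fin (n + 2)) (y : EuclideanSpace ℝ (Fin n)) :
    faceParam k y = faceParam k 0 + faceLinear k y := by
  ext j
  have h : ∀ i, 2 * k.insertNth (α := fun _ => ℝ) 0 (bary y) i - 1
      = 2 * k.insertNth (α := fun _ => ℝ) 0 (bary (0 : EuclideanSpace ℝ (Fin n))) i - 1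
        + k.insertNth (α := fun _ => ℝ) 0
          (Fin.cons (-∑ i, y i) fun i => y i : Fin (n + 1) → ℝ) i := by
    intro i
    induction i using k.succAboveCases with
    | x => simp
    | p j =>
      induction j using Fin.cases with
      | zero =>
        simp [bary, ← Finset.sum_div, Finset.sum_add_distrib]
        ring
      | succ j =>
        simp [bary]
        ring
  exact h j.succ

/-- The Gram matrix of the columns is `1 + 𝟙 𝟙ᵀ` on the oblique face, with determinant `n + 1`. On
the other faces the coordinate `-∑ y_i` is the dropped barycentric coordinate `0`, and the Gram
matrix is the identity. -/
theorem normDet_faceLinear {n : ℕ} (k : Fin (n + 2)) :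
    (faceLinear k).normDet = faceScale (n + 1) k := by
  have hsq := (faceLinear k).normDet_sq_eq_det_gram (EuclideanSpace.basisFun (Fin n) ℝ)
  rw [faceScale]
  split_ifs with hk
  · subst hk
    have hg : Matrix.gram ℝ (fun a => faceLinear 0 (EuclideanSpace.basisFun (Fin n) ℝ a))
        = 1 + ((Matrix.replicateCol Unit 1 : Matrix (Fin n) Unit ℝ)
          * (Matrix.replicateRow Unit 1 : Matrix Unit (Fin n) ℝ) : Matrix (Fin n) (Fin n) ℝ) := by
      ext a b
      simp [Matrix.gram_apply, faceLinear, PiLp.inner_apply, Fin.sum_univ_succ, Matrix.mul_apply,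
        Matrix.one_apply, add_comm, eq_comm]
    rw [hg, Matrix.det_one_add_replicateCol_mul_replicateRow] at hsq
    have : (faceLinear (0 : Fin (n + 2))).normDet ^ 2 = ((n + 1 : ℕ) : ℝ) := by
      simpa [dotProduct, add_comm] using hsq
    rw [← this, Real.sqrt_sq (LinearMap.normDet_nonneg _)]
  · obtain ⟨i, rfl⟩ := Fin.exists_succ_eq.2 hk
    have hg : Matrix.gram ℝ (fun a => faceLinear i.succ (EuclideanSpace.basisFun (Fin n) ℝ a))
        = 1 := by
      ext a b
      simp [Matrix.gram_apply, faceLinear, PiLp.inner_apply, Fin.sum_univ_succAbove _ i,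
        Matrix.one_apply, eq_comm]
    rw [hg, Matrix.det_one] at hsq
    have : (faceLinear i.succ).normDet ^ 2 = 1 := by simpa using hsq
    exact (pow_eq_one_iff_of_nonneg (LinearMap.normDet_nonneg _) two_ne_zero).1 this

theorem continuous_faceParam {n : ℕ} (k : Fin (n + 2)) : Continuous (faceParam k) := by
  have h : faceParam k = fun y => faceParam k 0 + faceLinear k y := funext (faceParam_eq k)
  rw [h]
  exact continuous_const.add (faceLinear k).continuous_of_finiteDimensional

theorem euclideanHausdorffMeasure_image_faceParam {n : ℕ} (k : Fin (n + 2))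
    (s : Set (EuclideanSpace ℝ (Fin n))) :
    μHE[n] (faceParam k '' s) = ENNReal.ofReal (faceScale (n + 1) k) * volume s := by
  have h := (faceLinear k).euclideanHausdorffMeasure_image_eq_normDet_mul_volume s
  rw [finrank_euclideanSpace_fin, normDet_faceLinear] at h
  rw [← h, ← (isometry_add_left (faceParam k 0)).euclideanHausdorffMeasure_image
      (faceLinear k '' s),
    Set.image_image]
  congr 2
  exact _root_.funext (faceParam_eq k)

theorem restrict_refFace {n : ℕ} (k : Fin (n + 2)) :
    (μHE[n] : Measure (EuclideanSpace ℝ (Fin (n + 1)))).restrict (refFace (n + 1) k)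
      = ENNReal.ofReal (faceScale (n + 1) k) •
        (volume.restrict (refSimplex n)).map (faceParam k) := by
  ext A hA
  rw [Measure.restrict_apply hA, Measure.smul_apply,
    Measure.map_apply (continuous_faceParam k).measurable hA,
    Measure.restrict_apply ((continuous_faceParam k).measurable hA), smul_eq_mul,
    ← euclideanHausdorffMeasure_image_faceParam, refFace_eq_image, Set.image_preimage_inter]

theorem eval_insertNth_zero {d : ℕ} (k : Fin (d + 1)) (t : Fin d → ℝ)
    (p : MvPolynomial (Fin (d + 1)) ℝ) :
    eval (k.insertNth (α := fun _ => ℝ) 0 t) p = eval t (faceTrace k p) := by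
  have h : (aeval (k.insertNth (α := fun _ => ℝ) 0 t) : MvPolynomial _ ℝ →ₐ[ℝ] ℝ)
      = (aeval t).comp (faceTrace k) := by
    ext i
    induction i using k.succAboveCases with
    | x => simp
    | p j => simp
  have := DFunLike.congr_fun h p
  simpa [aeval_eq_eval] using this

theorem faceScale_pos {n : ℕ} (k : Fin (n + 2)) : 0 < faceScale (n + 1) k := by
  unfold faceScale
  split_ifs <;> positivity

theorem integral_refFace_eval {n N : ℕ} (k : Fin (n + 2)) {p : MvPolynomial (Fin (n + 2)) ℝ}
    (hp : p.IsHomogeneous N) :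
    ∫ x in refFace (n + 1) k, eval (bary x) p ∂μHE[n]
      = faceScale (n + 1) k *
        (2 ^ n / (N + n)! * factorialFunctional (Fin (n + 1)) (faceTrace k p)) := by
  rw [restrict_refFace, integral_smul_measure, integral_map
    (continuous_faceParam k).measurable.aemeasurable,
    ENNReal.toReal_ofReal (faceScale_pos k).le, smul_eq_mul]
  · simp only [bary_faceParam, eval_insertNth_zero]
    rw [integral_refSimplex_eval (isHomogeneous_faceTrace k hp)]
  · exact (p.continuous_eval.comp (continuous_bary _)).aestronglyMeasurable

theorem faceMassMatrix_apply {n N : ℕ} (k : Fin (n + 2)) (α β : MultiIndex (n + 2) N) :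
    faceMassMatrix (n + 1) N k α β = faceScale (n + 1) k * (2 ^ n / (2 * N + n)!
      * factorialFunctional (Fin (n + 1)) (faceTrace k (bernsteinPoly β * bernsteinPoly α))) := by
  rw [two_mul, ← integral_refFace_eval k
    ((isHomogeneous_bernsteinPoly β).mul (isHomogeneous_bernsteinPoly α))]
  simp only [map_mul, eval_bernsteinPoly]
  rfl

/-! ### The spectrum of `L_0`. -/

section Spectrum

variable {m N : ℕ}

theorem hasEigenvalue_liftZero_iff (mu : ℝ) :
    Module.End.HasEigenvalue (liftZero m N).mulVecLin mu ↔
      ∃ p : MvPolynomial (Fin m) ℝ, p.IsHomogeneous N ∧ p ≠ 0 ∧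
        lowering (Fin m) (varSum (Fin m) * p) = (2 * mu) • p := by
  have key : ∀ u : MultiIndex m N → ℝ, liftZero m N *ᵥ u = mu • u ↔
      lowering (Fin m) (varSum (Fin m) * toPoly m N u) = (2 * mu) • toPoly m N u := by
    intro u
    rw [← toPoly_injective.eq_iff, toPoly_liftZero_mulVec, map_smul, mul_smul, one_div,
      inv_smul_eq_iff₀ two_ne_zero]
  constructor
  · intro h
    obtain ⟨u, hu⟩ := h.exists_hasEigenvector
    exact ⟨toPoly m N u, isHomogeneous_toPoly u,
      (map_ne_zero_iff _ toPoly_injective).2 hu.2, (key u).1 hu.apply_eq_smul⟩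
  · rintro ⟨p, hp, hp0, h⟩
    rw [← toPoly_ofPoly hp] at h hp0
    exact Module.End.hasEigenvalue_of_hasEigenvector (x := ofPoly m N p)
      ⟨Module.End.mem_eigenspace_iff.2 ((key _).2 h), fun h0 => hp0 (by rw [h0, map_zero])⟩

/-- A dimension count: the transposed elevation matrix maps to a space of smaller dimension, since
`α ↦ α + e_{i₀}` misses `(N + 1) e_{i₁}`. This needs a second variable. -/
theorem exists_lowering_eq_zero (hm : 2 ≤ m) (N : ℕ) :
    ∃ p : MvPolynomial (Fin m) ℝ, p.IsHomogeneous N ∧ p ≠ 0 ∧ lowering (Fin m) p = 0 := by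
  rcases N with _ | N
  · exact ⟨1, isHomogeneous_one _ _, one_ne_zero,
      lowering_of_isHomogeneous_zero (isHomogeneous_one _ _)⟩
  have i₀ : Fin m := ⟨0, by omega⟩
  have : Nontrivial (Fin m) := Fin.nontrivial_iff_two_le.2 hm
  obtain ⟨i₁, hi⟩ := exists_ne i₀
  have hcard : Fintype.card (MultiIndex m N) < Fintype.card (MultiIndex m (N + 1)) := by
    refine Fintype.card_lt_of_injective_of_notMem (fun α : MultiIndex m N => α.succ i₀)
      (b := ⟨Pi.single i₁ (N + 1), by simp⟩) (fun α β h => ?_) ?_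
    · exact Subtype.ext (add_right_cancel (congrArg Subtype.val h))
    · rintro ⟨α, hα⟩
      have := congrFun (congrArg Subtype.val hα) i₀
      simp [MultiIndex.succ, Pi.single_eq_of_ne hi.symm] at this
  have hker : LinearMap.ker (elevation m N)ᵀ.mulVecLin ≠ ⊥ :=
    LinearMap.ker_ne_bot_of_finrank_lt (by simpa using hcard)
  obtain ⟨u, hu, hu0⟩ := (Submodule.ne_bot_iff _).1 hker
  refine ⟨toPoly m (N + 1) u, isHomogeneous_toPoly u, (map_ne_zero_iff _ toPoly_injective).2 hu0, ?_⟩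
  rw [lowering_toPoly, show (elevation m N)ᵀ *ᵥ u = 0 from hu, map_zero, smul_zero]

/-- With one variable Euler's identity turns `lowering` into `N ∂`, which is injective on forms of
positive degree. This is why only `i = 0` occurs for `d = 1`. -/
theorem eq_zero_of_lowering_eq_zero {p : MvPolynomial (Fin 1) ℝ} (hp : p.IsHomogeneous N)
    (hp0 : p ≠ 0) (h : lowering (Fin 1) p = 0) : N = 0 := by
  by_contra hN
  have heuler := hp.sum_X_mul_pderiv
  rw [Fin.sum_univ_one] at heuler
  rw [lowering_apply, Fin.sum_univ_one, heuler, map_nsmul, smul_eq_zero_iff_right hN] at h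
  rw [h, mul_zero, eq_comm, smul_eq_zero_iff_right hN] at heuler
  exact hp0 heuler

/-- Descent along the ladder: if `lowering p ≠ 0`, it is an eigenvector one degree lower, with `2
mu` diminished by `2 N + m`. The index `i` is the degree in which the kernel of `lowering` is
reached. -/
theorem eq_traceEigenvalue_of_lowering_varSum_mul {mu : ℝ} {p : MvPolynomial (Fin m) ℝ}
    (hp : p.IsHomogeneous N) (hp0 : p ≠ 0)
    (h : lowering (Fin m) (varSum (Fin m) * p) = (2 * mu) • p) :
    ∃ i : ℕ, i ≤ N ∧ (m = 1 → i = 0) ∧ mu = traceEigenvalue m N i := by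
  have hcomm := lowering_varSum_mul hp
  rw [h, Fintype.card_fin] at hcomm
  by_cases hq : lowering (Fin m) p = 0
  · refine ⟨N, le_rfl, ?_, ?_⟩
    · rintro rfl
      exact eq_zero_of_lowering_eq_zero hp hp0 hq
    · rw [hq, mul_zero, add_zero] at hcomm
      have := smul_left_injective ℝ hp0 hcomm
      simp only [traceEigenvalue]
      linarith
  · induction N generalizing mu p with
    | zero => exact absurd (lowering_of_isHomogeneous_zero hp) hq
    | succ N ih =>
      have hq1 := isHomogeneous_lowering hp
      rw [Nat.add_sub_cancel] at hq1
      have h1 : varSum (Fin m) * lowering (Fin m) p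
          = (2 * mu - (2 * ((N + 1 : ℕ) : ℝ) + m)) • p := by
        rw [sub_smul, hcomm, add_sub_cancel_left]
      have h2 : lowering (Fin m) (varSum (Fin m) * lowering (Fin m) p)
          = (2 * (mu - (((N + 1 : ℕ) : ℝ) + m / 2))) • lowering (Fin m) p := by
        rw [h1, map_smul]
        congr 1
        ring
      have hcomm2 := lowering_varSum_mul hq1
      rw [h2, Fintype.card_fin] at hcomm2
      by_cases hq2 : lowering (Fin m) (lowering (Fin m) p) = 0
      · refine ⟨N, N.le_succ, ?_, ?_⟩
        · rintro rfl
          exact eq_zero_of_lowering_eq_zero hq1 hq hq2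
        · rw [hq2, mul_zero, add_zero] at hcomm2
          have := smul_left_injective ℝ hq hcomm2
          simp only [traceEigenvalue]
          push_cast at this ⊢
          linarith
      · obtain ⟨i, hi, him, hmu⟩ := ih hq1 hq h2 hcomm2 hq2
        refine ⟨i, hi.trans N.le_succ, him, ?_⟩
        simp only [traceEigenvalue] at hmu ⊢
        push_cast at hmu ⊢
        linarith

theorem exists_lowering_varSum_mul_eq {i : ℕ} (hm : 1 ≤ m) (hi : i ≤ N) (him : m = 1 → i = 0) :
    ∃ p : MvPolynomial (Fin m) ℝ, p.IsHomogeneous N ∧ p ≠ 0 ∧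
      lowering (Fin m) (varSum (Fin m) * p) = (2 * traceEigenvalue m N i) • p := by
  induction N, hi using Nat.le_induction with
  | base =>
    have : ∃ p : MvPolynomial (Fin m) ℝ, p.IsHomogeneous i ∧ p ≠ 0 ∧ lowering (Fin m) p = 0 := by
      rcases hm.eq_or_lt with h | h
      · rw [him h.symm]
        exact ⟨1, isHomogeneous_one _ _, one_ne_zero,
          lowering_of_isHomogeneous_zero (isHomogeneous_one _ _)⟩
      · exact exists_lowering_eq_zero h i
    obtain ⟨p, hp, hp0, h⟩ := this
    refine ⟨p, hp, hp0, ?_⟩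
    rw [lowering_varSum_mul hp, h, mul_zero, add_zero, Fintype.card_fin, traceEigenvalue]
    congr 1
    ring
  | succ N hi ih =>
    obtain ⟨p, hp, hp0, h⟩ := ih
    have hs : varSum (Fin m) ≠ 0 := by
      intro h0
      have h1 : eval (fun _ => (1 : ℝ)) (varSum (Fin m)) = m := by simp [varSum]
      rw [h0, map_zero] at h1
      have : (1 : ℝ) ≤ m := by exact_mod_cast hm
      linarith
    refine ⟨varSum (Fin m) * p, isHomogeneous_varSum_mul hp, mul_ne_zero hs hp0, ?_⟩
    rw [lowering_varSum_mul (isHomogeneous_varSum_mul hp), h, mul_smul_comm, ← add_smul,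
      Fintype.card_fin, traceEigenvalue, traceEigenvalue]
    congr 1
    push_cast
    ring

theorem setOf_hasEigenvalue_liftZero (hm : 1 ≤ m) :
    {mu : ℝ | Module.End.HasEigenvalue (liftZero m N).mulVecLin mu} =
      {mu : ℝ | ∃ i : ℕ, i ≤ N ∧ (m = 1 → i = 0) ∧ mu = traceEigenvalue m N i} := by
  ext mu
  simp only [Set.mem_ofPred_eq, hasEigenvalue_liftZero_iff]
  constructor
  · rintro ⟨p, hp, hp0, h⟩
    exact eq_traceEigenvalue_of_lowering_varSum_mul hp hp0 h
  · rintro ⟨i, hi, him, rfl⟩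
    exact exists_lowering_varSum_mul_eq hm hi him

theorem traceEigenvalue_pos {i : ℕ} (hm : 1 ≤ m) (hi : i ≤ N) : 0 < traceEigenvalue m N i := by
  have h1 : (1 : ℝ) ≤ m := by exact_mod_cast hm
  have h2 : (i : ℝ) ≤ N := by exact_mod_cast hi
  have h3 : (0 : ℝ) ≤ i := by positivity
  unfold traceEigenvalue
  have h4 : 0 < (N : ℝ) + i + m := by linarith
  have h5 : 0 < (N : ℝ) + 1 - i := by linarith
  positivity

end Spectrum

/-! ### Reduction of the generalized problem to `L_0`. -/

section Generalized

variable {n N : ℕ}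

/-- For `c ≠ 0` the maps `f` and `c⁻¹ • g` restrict to mutually inverse maps between the two
eigenspaces. -/
theorem finrank_eigenspace_comp_comm {K V W : Type*} [Field K] [AddCommGroup V] [Module K V]
    [AddCommGroup W] [Module K W] (f : V →ₗ[K] W) (g : W →ₗ[K] V) {c : K} (hc : c ≠ 0) :
    Module.finrank K (Module.End.eigenspace (g ∘ₗ f) c)
      = Module.finrank K (Module.End.eigenspace (f ∘ₗ g) c) := by
  have hf : ∀ x ∈ Module.End.eigenspace (g ∘ₗ f) c, f x ∈ Module.End.eigenspace (f ∘ₗ g) c := by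
    intro x hx
    rw [Module.End.mem_eigenspace_iff] at hx ⊢
    rw [LinearMap.comp_apply] at hx ⊢
    rw [hx, map_smul]
  have hg : ∀ x ∈ Module.End.eigenspace (f ∘ₗ g) c,
      (c⁻¹ • g) x ∈ Module.End.eigenspace (g ∘ₗ f) c := by
    intro x hx
    rw [Module.End.mem_eigenspace_iff] at hx ⊢
    rw [LinearMap.comp_apply] at hx ⊢
    rw [LinearMap.smul_apply, map_smul, hx, inv_smul_smul₀ hc, smul_inv_smul₀ hc]
  refine LinearEquiv.finrank_eq (LinearEquiv.ofLinearMap (f.restrict hf) ((c⁻¹ • g).restrict hg) ?_ ?_)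
  · ext ⟨x, hx⟩
    have h := Module.End.mem_eigenspace_iff.1 hx
    simp only [LinearMap.comp_apply] at h
    simp [h, inv_smul_smul₀ hc]
  · ext ⟨x, hx⟩
    have h := Module.End.mem_eigenspace_iff.1 hx
    simp only [LinearMap.comp_apply] at h
    simp [h, inv_smul_smul₀ hc]

/-- Restriction to the face `t_k = 0` in terms of Bernstein coefficients. -/
def coeffTrace (N : ℕ) (k : Fin (n + 2)) :
    (MultiIndex (n + 2) N → ℝ) →ₗ[ℝ] (MultiIndex (n + 1) N → ℝ) :=
  ofPoly (n + 1) N ∘ₗ (faceTrace k).toLinearMap ∘ₗ toPoly (n + 2) N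

/-- The lift `polyLift` from the face `t_k = 0` in terms of Bernstein coefficients. -/
def coeffLift (N : ℕ) (k : Fin (n + 2)) :
    (MultiIndex (n + 1) N → ℝ) →ₗ[ℝ] (MultiIndex (n + 2) N → ℝ) :=
  ofPoly (n + 2) N ∘ₗ polyLift k N ∘ₗ toPoly (n + 1) N

theorem toPoly_coeffTrace (k : Fin (n + 2)) (u : MultiIndex (n + 2) N → ℝ) :
    toPoly (n + 1) N (coeffTrace N k u) = faceTrace k (toPoly (n + 2) N u) :=
  toPoly_ofPoly (isHomogeneous_faceTrace k (isHomogeneous_toPoly u))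

theorem toPoly_coeffLift (k : Fin (n + 2)) (g : MultiIndex (n + 1) N → ℝ) :
    toPoly (n + 2) N (coeffLift N k g) = polyLift k N (toPoly (n + 1) N g) :=
  toPoly_ofPoly (isHomogeneous_polyLift k (isHomogeneous_toPoly g))

theorem coeffTrace_comp_coeffLift (k : Fin (n + 2)) :
    coeffTrace N k ∘ₗ coeffLift N k = (2 : ℝ) • (liftZero (n + 1) N).mulVecLin := by
  refine LinearMap.ext fun g => toPoly_injective ?_
  rw [LinearMap.comp_apply, toPoly_coeffTrace, toPoly_coeffLift, faceTrace_polyLift,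
    LinearMap.smul_apply, map_smul, Matrix.mulVecLin_apply, toPoly_liftZero_mulVec, smul_smul]
  norm_num

theorem dotProduct_massMatrix_mulVec {d : ℕ} (u v : MultiIndex (d + 1) N → ℝ) :
    v ⬝ᵥ massMatrix d N *ᵥ u = 2 ^ d / (2 * N + d)!
      * factorialFunctional (Fin (d + 1)) (toPoly (d + 1) N u * toPoly (d + 1) N v) := by
  have h := factorialFunctional_toPoly_mul_toPoly (AlgHom.id ℝ _) u v
  simp only [AlgHom.coe_id, id] at h
  simp only [h, dotProduct, Matrix.mulVec, massMatrix_apply, Finset.mul_sum]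
  rw [Finset.sum_comm]
  exact Finset.sum_congr rfl fun α _ => Finset.sum_congr rfl fun β _ => by ring

theorem dotProduct_faceMassMatrix_mulVec (k : Fin (n + 2)) (u v : MultiIndex (n + 2) N → ℝ) :
    v ⬝ᵥ faceMassMatrix (n + 1) N k *ᵥ u = faceScale (n + 1) k * (2 ^ n / (2 * N + n)!
      * factorialFunctional (Fin (n + 1))
          (faceTrace k (toPoly (n + 2) N u) * faceTrace k (toPoly (n + 2) N v))) := by
  have h := factorialFunctional_toPoly_mul_toPoly (faceTrace k) u v
  simp only [h, dotProduct, Matrix.mulVec, faceMassMatrix_apply, Finset.mul_sum]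
  rw [Finset.sum_comm]
  exact Finset.sum_congr rfl fun α _ => Finset.sum_congr rfl fun β _ => by ring

theorem massMatrix_mulVec_injective (d N : ℕ) :
    Function.Injective (massMatrix d N).mulVecLin := by
  rw [← LinearMap.ker_eq_bot, LinearMap.ker_eq_bot']
  intro u hu
  have h := dotProduct_massMatrix_mulVec u u
  rw [← Matrix.mulVecLin_apply, hu, dotProduct_zero, eq_comm, mul_eq_zero] at h
  exact eq_zero_of_factorialFunctional_toPoly_mul_self (h.resolve_left (by positivity))

/-- Both sides are tested against every `v`. The factor `2 N + n + 1` from the lift turns `1 /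
(2N+n+1)!` into `1 / (2N+n)!`, and the powers `2^(n+1)` and `2^n` account for the division by `2`.
-/
theorem faceMassMatrix_mulVec (k : Fin (n + 2)) (u : MultiIndex (n + 2) N → ℝ) :
    faceMassMatrix (n + 1) N k *ᵥ u
      = (faceScale (n + 1) k / 2) •
        (massMatrix (n + 1) N *ᵥ coeffLift N k (coeffTrace N k u)) := by
  refine dotProduct_eq _ _ fun v => ?_
  rw [dotProduct_comm, dotProduct_comm _ v, dotProduct_smul, dotProduct_faceMassMatrix_mulVec,
    dotProduct_massMatrix_mulVec, toPoly_coeffLift, factorialFunctional_polyLift_mul k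
      (isHomogeneous_toPoly _) (isHomogeneous_toPoly v), toPoly_coeffTrace, ← add_assoc,
    Nat.factorial_succ, smul_eq_mul]
  push_cast
  field_simp
  ring

theorem generalizedSolutions_eq_eigenspace (k : Fin (n + 2)) (mu : ℝ) :
    generalizedSolutions (faceMassMatrix (n + 1) N k) (massMatrix (n + 1) N)
        (faceScale (n + 1) k * mu)
      = Module.End.eigenspace (coeffLift N k ∘ₗ coeffTrace N k) (2 * mu) := by
  ext u
  have hc := (faceScale_pos k).ne'
  rw [generalizedSolutions, LinearMap.mem_ker, LinearMap.sub_apply, LinearMap.smul_apply,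
    sub_eq_zero, Matrix.mulVecLin_apply, Matrix.mulVecLin_apply, faceMassMatrix_mulVec,
    Module.End.mem_eigenspace_iff, LinearMap.comp_apply,
    ← (massMatrix_mulVec_injective (n + 1) N).eq_iff (b := (2 * mu) • u), map_smul, Matrix.mulVecLin_apply,
    Matrix.mulVecLin_apply, div_eq_mul_inv, mul_smul, mul_smul, mul_smul,
    (smul_right_injective _ hc).eq_iff, inv_smul_eq_iff₀ two_ne_zero]

theorem finrank_generalizedSolutions (k : Fin (n + 2)) {mu : ℝ} (hmu : mu ≠ 0) :
    Module.finrank ℝ (generalizedSolutions (faceMassMatrix (n + 1) N k) (massMatrix (n + 1) N)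
        (faceScale (n + 1) k * mu))
      = Module.finrank ℝ (Module.End.eigenspace (liftZero (n + 1) N).mulVecLin mu) := by
  rw [generalizedSolutions_eq_eigenspace,
    finrank_eigenspace_comp_comm _ _ (mul_ne_zero two_ne_zero hmu), coeffTrace_comp_coeffLift]
  have h : Module.End.eigenspace ((2 : ℝ) • (liftZero (n + 1) N).mulVecLin) (2 * mu)
      = Module.End.eigenspace (liftZero (n + 1) N).mulVecLin mu := by
    ext g
    rw [Module.End.mem_eigenspace_iff, Module.End.mem_eigenspace_iff, LinearMap.smul_apply, mul_smul,
      (smul_right_injective _ (two_ne_zero' ℝ)).eq_iff]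
  rw [h]

theorem isGeneralizedEigenvalue_iff {ι : Type*} [Fintype ι] (A B : Matrix ι ι ℝ) (lam : ℝ) :
    IsGeneralizedEigenvalue A B lam ↔ Module.finrank ℝ (generalizedSolutions A B lam) ≠ 0 := by
  rw [Ne, Submodule.finrank_eq_zero, ← Ne, Submodule.ne_bot_iff]
  simp only [IsGeneralizedEigenvalue, generalizedSolutions, LinearMap.mem_ker, LinearMap.sub_apply,
    LinearMap.smul_apply, sub_eq_zero, Matrix.mulVecLin_apply, and_comm]

theorem setOf_isGeneralizedEigenvalue (k : Fin (n + 2)) :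
    {lam : ℝ | lam ≠ 0 ∧ IsGeneralizedEigenvalue (faceMassMatrix (n + 1) N k)
        (massMatrix (n + 1) N) lam} =
      (fun mu : ℝ => faceScale (n + 1) k * mu) ''
        {mu : ℝ | Module.End.HasEigenvalue (liftZero (n + 1) N).mulVecLin mu} := by
  have hc := (faceScale_pos k).ne'
  have key : ∀ mu : ℝ, mu ≠ 0 → (IsGeneralizedEigenvalue (faceMassMatrix (n + 1) N k)
      (massMatrix (n + 1) N) (faceScale (n + 1) k * mu) ↔
        Module.End.HasEigenvalue (liftZero (n + 1) N).mulVecLin mu) := fun mu hmu => by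
    rw [isGeneralizedEigenvalue_iff, finrank_generalizedSolutions k hmu, Ne,
      Submodule.finrank_eq_zero, Module.End.hasEigenvalue_iff]
  ext lam
  simp only [Set.mem_ofPred_eq, Set.mem_image]
  constructor
  · rintro ⟨h0, h⟩
    have h1 : faceScale (n + 1) k * (lam / faceScale (n + 1) k) = lam := mul_div_cancel₀ lam hc
    refine ⟨lam / faceScale (n + 1) k, (key _ (div_ne_zero h0 hc)).1 (by rwa [h1]), h1⟩
  · rintro ⟨mu, h, rfl⟩
    have h1 : mu ∈ {mu : ℝ | Module.End.HasEigenvalue (liftZero (n + 1) N).mulVecLin mu} := h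
    -- The set on the right does not exclude `0`, so the explicit spectrum is used to see that every
    -- eigenvalue of `L_0` is positive.
    rw [setOf_hasEigenvalue_liftZero n.succ_pos] at h1
    obtain ⟨i, hi, -, h2⟩ := h1
    have hmu : mu ≠ 0 := by
      rw [h2]
      exact (traceEigenvalue_pos n.succ_pos hi).ne'
    exact ⟨mul_ne_zero hc hmu, (key mu hmu).2 h⟩

end Generalized

end BernsteinLift

end

theorem mainTheorem4 (d N : ℕ) (hd : 1 ≤ d) :
    -- the nonzero generalized eigenvalues are a fixed scaling of the eigenvalues of `L_0`
    (∀ k : Fin (d + 1),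
      {lam : ℝ | lam ≠ 0 ∧
          IsGeneralizedEigenvalue (faceMassMatrix d N k) (massMatrix d N) lam} =
        (fun mu : ℝ => faceScale d k * mu) ''
          {mu : ℝ | Module.End.HasEigenvalue (liftZero d N).mulVecLin mu}) ∧
    -- with the same multiplicities
    (∀ (k : Fin (d + 1)) (mu : ℝ), mu ≠ 0 →
      Module.finrank ℝ
          (generalizedSolutions (faceMassMatrix d N k) (massMatrix d N) (faceScale d k * mu)) =
        Module.finrank ℝ (Module.End.eigenspace (liftZero d N).mulVecLin mu)) ∧
    -- the generalized eigenvalues explicitly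
    (∀ k : Fin (d + 1),
      {lam : ℝ | lam ≠ 0 ∧
          IsGeneralizedEigenvalue (faceMassMatrix d N k) (massMatrix d N) lam} =
        {lam : ℝ | ∃ i : ℕ, i ≤ N ∧ (d = 1 → i = 0) ∧
          lam = faceScale d k * traceEigenvalue d N i}) ∧
    -- the eigenvalues of `L_0` explicitly
    {mu : ℝ | Module.End.HasEigenvalue (liftZero d N).mulVecLin mu} =
      {mu : ℝ | ∃ i : ℕ, i ≤ N ∧ (d = 1 → i = 0) ∧ mu = traceEigenvalue d N i} := by
  -- The faces are parametrized by the reference simplex of dimension `n`; for `d = 1` this is a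
  -- point, so no separate case arises.
  obtain ⟨n, rfl⟩ : ∃ n, d = n + 1 := ⟨d - 1, by omega⟩
  refine ⟨setOf_isGeneralizedEigenvalue, fun k mu hmu => finrank_generalizedSolutions k hmu, fun k => ?_,
    setOf_hasEigenvalue_liftZero hd⟩
  rw [setOf_isGeneralizedEigenvalue, setOf_hasEigenvalue_liftZero hd]
  ext lam
  simp only [Set.mem_image, Set.mem_ofPred_eq]
  constructor
  · rintro ⟨mu, ⟨i, hi, hd1, rfl⟩, rfl⟩
    exact ⟨i, hi, hd1, rfl⟩
  · rintro ⟨i, hi, hd1, rfl⟩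
    exact ⟨_, ⟨i, hi, hd1, rfl⟩, rfl⟩
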